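/- Let $\mathcal H$ be a complex Hilbert space, $(S(t))_{t\ge 0}$ a strongly continuous semigroup of bounded operators on $\mathcal H$ with $S(0)=I$, and $A$ its generator, with spectrum $\sigma(A)$. Let $\omega\in\mathbb R$ be such that the closed half-plane $\{\operatorname{Re} z\ge\omega\}$ is contained in the resolvent set of $A$ and $\|(z-A)^{-1}\|$ is uniformly bounded on it. Let $m:[0,\infty[\to\,]0,\infty[$ be a continuous function with $m(t)\ge\|S(t)\|$ for all $t\ge 0$. Let $\widetilde\omega<\omega$. Assume that $A$ has no spectrum on the line $\operatorname{Re} z=\widetilde\omega$, that $\sigma_+:=\{z\in\sigma(A):\operatorname{Re} z>\widetilde\omega\}$ is compact, and that for every neighborhood $U$ of $\sigma_+$ the norm $\|(z-A)^{-1}\|$ is uniformly bounded on $\{z\in\mathbb C:\operatorname{Re} z\ge\widetilde\omega\}\setminus U$. Define $r(\widetilde\omega)$ by $$\frac1{r(\widetilde\omega)}=\sup_{\operatorname{Re} z=\widetilde\omega}\|(z-A)^{-1}\| .$$ Let $$\Pi_+=\frac1{2\pi i}\int_{\partial V}(z-A)^{-1}\,dz,$$ where $V$ is any compact neighborhood of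 $\sigma_+$ with $C^1$ boundary, disjoint from $\sigma(A)\setminus\sigma_+$, and $\partial V$ is positively oriented (that is, $V$ lies to the left of $\partial V$). Then $\Pi_+$ is a projection ($\Pi_+^2=\Pi_+$) which does not depend on the choice of $V$, and for every $t>0$ $$S(t)=S(t)\Pi_++R(t),\qquad R(t)=S(t)(I-\Pi_+),$$ where for all $a,\widetilde a>0$ with $a+\widetilde a=t$, $$\|R(t)\|\le\frac{e^{\widetilde\omega t}}{r(\widetilde\omega)\,\bigl\|\tfrac1m\bigr\|_{e^{-\widetilde\omega\cdot}L^2([0,a])}\,\bigl\|\tfrac1m\bigr\|_{e^{-\widetilde\omega\cdot}L^2([0,\widetilde a])}}\;\|I-\Pi_+\| .$$ Here $\|f\|_{e^{-\widetilde\omega\cdot}L^2([0,a])}=\Bigl(\int_0^a e^{2\widetilde\omega s}|f(s)|^2\,ds\Bigr)^{1/2}$. (If $\mathcal H=\{0\}$, then $r(\widetilde\omega)=\infty$ and the bound is read as $\|R(t)\|\le 0$.) -/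

import Mathlib

open Set Filter Topology

/-- A strongly continuous one-parameter semigroup of bounded operators `S t`, `t ≥ 0`, with
`S 0 = I`. The values of `toFun` at negative times carry no information. -/
structure C0Semigroup (H : Type*) [NormedAddCommGroup H] [NormedSpace ℂ H] where
  toFun : ℝ → H →L[ℂ] H
  map_zero : toFun 0 = ContinuousLinearMap.id ℂ H
  map_add : ∀ s t : ℝ, 0 ≤ s → 0 ≤ t → toFun (s + t) = toFun s ∘L toFun t
  strongly_continuous : ∀ v : H, ContinuousOn (fun t : ℝ => toFun t v) (Ici 0)

namespace C0Semigroup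

/-- `w` is the derivative at `0` from the right of the orbit `t ↦ S t v`. -/
def HasGenerator {H : Type*} [NormedAddCommGroup H] [NormedSpace ℂ H]
    (S : C0Semigroup H) (v w : H) : Prop :=
  Tendsto (fun t : ℝ => (t : ℂ)⁻¹ • (S.toFun t v - v)) (𝓝[>] 0) (𝓝 w)

theorem HasGenerator.unique {H : Type*} [NormedAddCommGroup H] [NormedSpace ℂ H]
    {S : C0Semigroup H} {v w w' : H} (h : S.HasGenerator v w) (h' : S.HasGenerator v w') :
    w = w' :=
  tendsto_nhds_unique h h'

theorem HasGenerator.add {H : Type*} [NormedAddCommGroup H] [NormedSpace ℂ H]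
    {S : C0Semigroup H} {v w v' w' : H} (h : S.HasGenerator v w) (h' : S.HasGenerator v' w') :
    S.HasGenerator (v + v') (w + w') := by
  refine (Tendsto.add h h').congr fun t => ?_
  rw [← smul_add, (S.toFun t).map_add v v']
  congr 1
  abel

theorem HasGenerator.smul {H : Type*} [NormedAddCommGroup H] [NormedSpace ℂ H]
    {S : C0Semigroup H} {v w : H} (c : ℂ) (h : S.HasGenerator v w) :
    S.HasGenerator (c • v) (c • w) := by
  refine (Tendsto.const_smul h c).congr fun t => ?_
  rw [(S.toFun t).map_smul, ← smul_sub, smul_comm]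

theorem HasGenerator.zero {H : Type*} [NormedAddCommGroup H] [NormedSpace ℂ H]
    (S : C0Semigroup H) : S.HasGenerator 0 0 := by
  simp [HasGenerator]

/-- The (infinitesimal) generator of the semigroup, an unbounded operator: its domain consists of
all `v` for which `(S t v - v) / t` converges in norm as `t → 0+`, and it sends `v` to the limit. -/
noncomputable def generator {H : Type*} [NormedAddCommGroup H] [NormedSpace ℂ H]
    (S : C0Semigroup H) : H →ₗ.[ℂ] H where
  domain :=
    { carrier := {v | ∃ w, S.HasGenerator v w}
      add_mem' := fun ⟨_, h⟩ ⟨_, h'⟩ => ⟨_, h.add h'⟩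
      zero_mem' := ⟨0, HasGenerator.zero S⟩
      smul_mem' := fun c _ ⟨_, h⟩ => ⟨_, h.smul c⟩ }
  toFun :=
    { toFun := fun v => Classical.choose v.2
      map_add' := fun v v' => (Classical.choose_spec (v + v').2).unique
        ((Classical.choose_spec v.2).add (Classical.choose_spec v'.2))
      map_smul' := fun c v => (Classical.choose_spec (c • v).2).unique
        ((Classical.choose_spec v.2).smul c) }

end C0Semigroup

namespace UnboundedOperator

/-- The bounded operator `R` is a two-sided inverse of `z - A : D(A) → H`. -/
def IsResolventAt {H : Type*} [NormedAddCommGroup H] [NormedSpace ℂ H]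
    (A : H →ₗ.[ℂ] H) (z : ℂ) (R : H →L[ℂ] H) : Prop :=
  (∀ v : H, ∃ h : R v ∈ A.domain, z • R v - A ⟨R v, h⟩ = v) ∧
    ∀ u : A.domain, R (z • (u : H) - A u) = u

/-- The resolvent set of an unbounded operator. -/
def resolventSet {H : Type*} [NormedAddCommGroup H] [NormedSpace ℂ H]
    (A : H →ₗ.[ℂ] H) : Set ℂ :=
  {z | ∃ R : H →L[ℂ] H, IsResolventAt A z R}

/-- The spectrum of an unbounded operator. -/
def spectrum {H : Type*} [NormedAddCommGroup H] [NormedSpace ℂ H]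
    (A : H →ₗ.[ℂ] H) : Set ℂ :=
  (resolventSet A)ᶜ

open Classical in
/-- The resolvent `(z - A)⁻¹`, with the value `0` for `z` in the spectrum. -/
noncomputable def resolvent {H : Type*} [NormedAddCommGroup H] [NormedSpace ℂ H]
    (A : H →ₗ.[ℂ] H) (z : ℂ) : H →L[ℂ] H :=
  if h : z ∈ resolventSet A then Classical.choose h else 0

/-- The inverse `(z - A)⁻¹` is unique, so that `resolvent` is the resolvent. -/
theorem IsResolventAt.resolvent_eq {H : Type*} [NormedAddCommGroup H] [NormedSpace ℂ H]
    {A : H →ₗ.[ℂ] H} {z : ℂ} {R : H →L[ℂ] H} (hR : IsResolventAt A z R) :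
    resolvent A z = R := by
  have hz : z ∈ resolventSet A := ⟨R, hR⟩
  have hQ := Classical.choose_spec hz
  rw [resolvent, dif_pos hz]
  ext v
  obtain ⟨h, hv⟩ := hR.1 v
  have := hQ.2 ⟨R v, h⟩
  rwa [hv] at this

/-- `‖(z - A)⁻¹‖` is (defined and) uniformly bounded on the set `Ω`. -/
def ResolventBoundedOn {H : Type*} [NormedAddCommGroup H] [NormedSpace ℂ H]
    (A : H →ₗ.[ℂ] H) (Ω : Set ℂ) : Prop :=
  Ω ⊆ resolventSet A ∧ ∃ C : ℝ, ∀ z ∈ Ω, ‖resolvent A z‖ ≤ C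

/-- The part of the spectrum in the open half-plane `Re z > ω`. -/
def spectrumRight {H : Type*} [NormedAddCommGroup H] [NormedSpace ℂ H]
    (A : H →ₗ.[ℂ] H) (ω : ℝ) : Set ℂ :=
  {z | z ∈ spectrum A ∧ ω < z.re}

/-- The number `r` with `1 / r = sup_{Re z = ω} ‖(z - A)⁻¹‖`. -/
noncomputable def lineRadius {H : Type*} [NormedAddCommGroup H] [NormedSpace ℂ H]
    (A : H →ₗ.[ℂ] H) (ω : ℝ) : ℝ :=
  (sSup ((fun z : ℂ => ‖resolvent A z‖) '' {z | z.re = ω}))⁻¹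

/-- `(2πi)⁻¹ ∑ⱼ ∫_{γⱼ} (z - A)⁻¹ dz`, the curves being parametrized over a period `[0, 1]`. -/
noncomputable def rieszIntegral {H : Type*} [NormedAddCommGroup H] [NormedSpace ℂ H]
    (A : H →ₗ.[ℂ] H) {n : ℕ} (γ : Fin n → ℝ → ℂ) : H →L[ℂ] H :=
  (2 * (Real.pi : ℂ) * Complex.I)⁻¹ •
    ∑ j, ∫ t in (0 : ℝ)..1, deriv (γ j) t • resolvent A (γ j t)

end UnboundedOperator

/-- The planar set `V` has a `C¹` boundary, and the closed curves `γ j` parametrize it with its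
positive orientation: they are regular simple closed `C¹` curves, pairwise disjoint, which fill the
topological boundary of `V`, and at each boundary point `V` lies on the left of the curve (in the
direction `i γ'`) and the complement of `V` on the right. -/
structure IsOrientedC1Boundary (V : Set ℂ) {n : ℕ} (γ : Fin n → ℝ → ℂ) : Prop where
  contDiff : ∀ j, ContDiff ℝ 1 (γ j)
  periodic : ∀ j, Function.Periodic (γ j) 1
  deriv_ne_zero : ∀ j t, deriv (γ j) t ≠ 0
  simple_disjoint : ∀ j k, ∀ s ∈ Ico (0 : ℝ) 1, ∀ t ∈ Ico (0 : ℝ) 1,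
    γ j s = γ k t → j = k ∧ s = t
  iUnion_range : ⋃ j, range (γ j) = frontier V
  left_mem : ∀ j t, ∀ᶠ ε : ℝ in 𝓝[>] 0,
    γ j t + (ε : ℂ) * (Complex.I * deriv (γ j) t) ∈ interior V
  right_notMem : ∀ j t, ∀ᶠ ε : ℝ in 𝓝[>] 0,
    γ j t - (ε : ℂ) * (Complex.I * deriv (γ j) t) ∉ V

/-- `V` is a compact neighborhood of `τ`, disjoint from `σ \ τ`, with `C¹` boundary
parametrized by the curves `γ j`. -/
structure IsRieszContour (σ τ V : Set ℂ) {n : ℕ} (γ : Fin n → ℝ → ℂ) : Prop where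
  isCompact : IsCompact V
  mem_nhdsSet : V ∈ 𝓝ˢ τ
  disjoint : Disjoint V (σ \ τ)
  boundary : IsOrientedC1Boundary V γ

/-- The norm of `f` in the weighted space `e^{-ω·} L²([0, a])`, that is, the norm of
`s ↦ e^{ω s} f s` in `L²([0, a])`. -/
noncomputable def weightedL2Norm (ω a : ℝ) (f : ℝ → ℝ) : ℝ :=
  √(∫ s in (0 : ℝ)..a, (Real.exp (ω * s) * f s) ^ 2)

/-!
Write `R(z) = (z - A)⁻¹`, and let `Γ` be the oriented boundary of the contour set `V`.

*The projection.* The index of `Γ` is `1` in the interior of `V` and `0` outside `V`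
(`IsOrientedC1Boundary.contourCauchyIntegral_one_eq`). Mathlib has no Cauchy theorem for such
contours, and the index is all that is needed of one. Its difference with the indicator function
of `V` is locally constant off `Γ`, does not jump across `Γ`, and vanishes at infinity. By the
resolvent identity the Cauchy integral `T(w) = (2πi)⁻¹ ∫_Γ R(z) / (z - w) dz` is therefore
`R(w) (1 - P)` in the interior of `V` and `-R(w) P` outside, wherever `R(w)` is defined; so
`R(w) (1 - P)` extends holomorphically to the interior of `V`, and `R(w) P` to the complement of
`V`, where it tends to `0` at infinity. Hence `R(w) P (1 - P)` extends to an entire function that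
vanishes at infinity, and is zero by Liouville's theorem
(`UnboundedOperator.eq_zero_of_resolvent_comp_extends`). Since `R(w)` is injective, `P² = P`. The
same argument, for the difference of the projections of two contours, gives independence of the
contour.

*The bound.* Let `u` be in the kernel of `P` and let `χ` be a cutoff function on `[0, L]` that
vanishes at both ends. Integration by parts gives
`∫ e^{-z t} χ(t) S(t) u dt = E(z) ∫ e^{-z t} χ'(t) S(t) u dt` for each left inverse `E(z)` of
`z - A` modulo `P`. On the line `Re z = x` Plancherel's theorem turns a bound `‖E(z)‖ ≤ C` into
`∫ e^{-2 x t} χ² ‖S(t) u‖² dt ≤ C² ∫ e^{-2 x t} χ'² ‖S(t) u‖² dt`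
(`C0Semigroup.integral_weighted_sq_le_of_vanishing`). For `Re z ≥ ω'` there are such left inverses
with a uniform bound: `R(z) (1 - P)` away from the part of the spectrum that `V` encloses, and
`T(z)` near it. With an exponential as cutoff function, the estimate lowers the exponent for which
`e^{-x t} ‖S(t) u‖` is square integrable by a fixed amount, so that finitely many steps lead from
the growth bound of the semigroup down to `x = ω'`. On the line `Re z = ω'` itself `R(z)` is a left
inverse with `C = 1 / r(ω')`; taking `χ'` proportional to `e^{2 ω' s} / m(s)²` on `[0, a]` bounds
`e^{-ω' s} ‖S(s) u‖` in `L²([a, t])`, and `‖S(t) u‖ ≤ m(t - s) ‖S(s) u‖` converts this into the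
bound at time `t`.
-/

/-! ### Plancherel's theorem for Hilbert space valued functions -/

section Plancherel

open MeasureTheory FourierTransform
open scoped SchwartzMap

variable {F : Type*} [NormedAddCommGroup F] [InnerProductSpace ℂ F] [CompleteSpace F]

/-- On `L¹ ∩ L²` the isometric Fourier transform of `L²` is given by the Fourier integral: the two
agree as tempered distributions. -/
theorem fourier_toLp_ae_eq {f : ℝ → F} (hf : Integrable f) (hf2 : MemLp f 2) :
    (𝓕 (hf2.toLp f) : Lp (α := ℝ) F 2) =ᵐ[volume] 𝓕 f := by
  have hcont : Continuous (𝓕 f) :=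
    VectorFourier.fourierIntegral_continuous Real.continuous_fourierChar
      (by simp only [innerₗ_apply_apply]; fun_prop) hf
  refine ae_eq_of_integral_contDiff_smul_eq
    ((Lp.memLp _).locallyIntegrable (by norm_num)) hcont.locallyIntegrable fun g hg hgc => ?_
  have hgc' : HasCompactSupport (fun x => (g x : ℂ)) := hgc.comp_left (g := ((↑) : ℝ → ℂ)) (by simp)
  let φ : 𝓢(ℝ, ℂ) := hgc'.toSchwartzMap (Complex.ofRealCLM.contDiff.comp hg)
  have hφ : ∀ x, φ x = (g x : ℂ) := fun x => rfl
  have h1 := congrArg (fun T : 𝓢'(ℝ, F) => T φ) (Lp.fourier_toTemperedDistribution_eq (hf2.toLp f))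
  simp only [TemperedDistribution.fourier_apply, Lp.toTemperedDistribution_apply] at h1
  have h2 : ∫ x, (𝓕 φ) x • (hf2.toLp f) x = ∫ x, (𝓕 φ) x • f x := by
    refine integral_congr_ae ?_
    filter_upwards [hf2.coeFn_toLp] with x hx
    rw [hx]
  have h3 : ∫ x, (𝓕 φ) x • f x = ∫ x, φ x • 𝓕 f x := by
    have := VectorFourier.integral_fourierIntegral_smul_eq_flip (μ := volume) (ν := volume)
      (L := innerₗ ℝ) Real.continuous_fourierChar
      (by simp only [innerₗ_apply_apply]; fun_prop) (f := φ) (g := f) φ.integrable hf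
    simpa [SchwartzMap.fourier_coe, Real.fourier_eq, VectorFourier.fourierIntegral,
      real_inner_comm] using this
  rw [h2, h3] at h1
  simp only [hφ] at h1
  simpa using h1.symm

theorem eLpNorm_fourier_eq {f : ℝ → F} (hf : Integrable f) (hf2 : MemLp f 2) :
    eLpNorm (𝓕 f) 2 = eLpNorm f 2 := by
  rw [← eLpNorm_congr_ae (fourier_toLp_ae_eq hf hf2), ← eLpNorm_congr_ae hf2.coeFn_toLp]
  have := Lp.norm_fourier_eq (hf2.toLp f)
  rw [Lp.norm_def, Lp.norm_def] at this
  exact (ENNReal.toReal_eq_toReal_iff' (Lp.eLpNorm_ne_top _) (Lp.eLpNorm_ne_top _)).1 this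

/-- A pointwise bound between Fourier transforms gives an `L²` bound between the functions. -/
theorem integral_norm_sq_le_of_norm_fourier_le {f g : ℝ → F} (hf : Integrable f)
    (hf2 : MemLp f 2) (hg : Integrable g) (hg2 : MemLp g 2) {C : ℝ}
    (h : ∀ ξ, ‖𝓕 g ξ‖ ≤ C * ‖𝓕 f ξ‖) :
    ∫ t, ‖g t‖ ^ 2 ≤ C ^ 2 * ∫ t, ‖f t‖ ^ 2 := by
  have h1 : eLpNorm g 2 ≤ ENNReal.ofReal C * eLpNorm f 2 := by
    rw [← eLpNorm_fourier_eq hf hf2, ← eLpNorm_fourier_eq hg hg2]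
    exact eLpNorm_le_mul_eLpNorm_of_ae_le_mul (Eventually.of_forall h) 2
  have key : ∀ {f : ℝ → F}, MemLp f 2 → (∫ t, ‖f t‖ ^ 2) = (eLpNorm f 2).toReal ^ 2 := by
    intro f hf2
    rw [hf2.eLpNorm_eq_integral_rpow_norm (by norm_num) (by norm_num),
      ENNReal.toReal_ofReal (by positivity)]
    have h0 : 0 ≤ ∫ t, ‖f t‖ ^ 2 := integral_nonneg fun t => by positivity
    simp only [ENNReal.toReal_ofNat, Real.rpow_ofNat]
    rw [← Real.rpow_natCast, ← Real.rpow_mul h0]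
    norm_num
  rw [key hf2, key hg2, ← mul_pow]
  by_cases hC : 0 ≤ C
  · gcongr
    have := ENNReal.toReal_mono (ENNReal.mul_ne_top ENNReal.ofReal_ne_top hf2.eLpNorm_ne_top) h1
    rwa [ENNReal.toReal_mul, ENNReal.toReal_ofReal hC] at this
  · rw [ENNReal.ofReal_of_nonpos (le_of_not_ge hC), zero_mul, nonpos_iff_eq_zero] at h1
    rw [h1]
    simp only [ENNReal.toReal_zero, ne_eq, OfNat.ofNat_ne_zero, not_false_eq_true, zero_pow]
    positivity

end Plancherel

/-! ### The resolvent of an unbounded operator -/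

namespace UnboundedOperator

variable {H : Type*} [NormedAddCommGroup H] [NormedSpace ℂ H] {A : H →ₗ.[ℂ] H} {z w : ℂ}

theorem isResolventAt_resolvent (hz : z ∈ resolventSet A) : IsResolventAt A z (resolvent A z) := by
  obtain ⟨R, hR⟩ := hz
  rwa [hR.resolvent_eq]

theorem resolvent_injective (hz : z ∈ resolventSet A) {u v : H}
    (h : resolvent A z u = resolvent A z v) : u = v := by
  obtain ⟨h1, h1'⟩ := (isResolventAt_resolvent hz).1 u
  obtain ⟨h2, h2'⟩ := (isResolventAt_resolvent hz).1 v
  rw [← h1', ← h2']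
  simp only [h]

theorem resolvent_apply_sub (hz : z ∈ resolventSet A) (u : A.domain) :
    resolvent A z (w • (u : H) - A u) = (w - z) • resolvent A z u + u := by
  have h := (isResolventAt_resolvent hz).2 u
  have : w • (u : H) - A u = (w - z) • (u : H) + (z • (u : H) - A u) := by
    rw [sub_smul]; abel
  rw [this, map_add, map_smul, h]

/-- The first resolvent identity. -/
theorem resolvent_sub_resolvent (hz : z ∈ resolventSet A) (hw : w ∈ resolventSet A) :
    resolvent A w - resolvent A z = (z - w) • (resolvent A w ∘L resolvent A z) := by
  ext v
  obtain ⟨h1, h1'⟩ := (isResolventAt_resolvent hz).1 v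
  have := resolvent_apply_sub (w := z) hw ⟨_, h1⟩
  rw [h1'] at this
  simp [this]

theorem resolvent_commute (hz : z ∈ resolventSet A) (hw : w ∈ resolventSet A) :
    resolvent A w ∘L resolvent A z = resolvent A z ∘L resolvent A w := by
  rcases eq_or_ne z w with rfl | hne
  · rfl
  have h1 := resolvent_sub_resolvent hz hw
  have h2 := resolvent_sub_resolvent hw hz
  have h3 : (z - w) • (resolvent A w ∘L resolvent A z) =
      (z - w) • (resolvent A z ∘L resolvent A w) := by
    rw [← h1, ← neg_sub, h2, ← neg_smul, neg_sub]
  exact smul_right_injective _ (sub_ne_zero.2 hne) h3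

theorem isOpen_resolventSet [CompleteSpace H] (A : H →ₗ.[ℂ] H) : IsOpen (resolventSet A) := by
  rw [isOpen_iff_mem_nhds]
  intro z hz
  set R := resolvent A z with hR
  have hRz := isResolventAt_resolvent hz
  have hlim : Tendsto (fun w : ℂ => ‖(z - w) • R‖) (𝓝 z) (𝓝 0) := by
    have : Continuous fun w : ℂ => ‖(z - w) • R‖ := by fun_prop
    simpa using this.tendsto z
  filter_upwards [hlim.eventually (gt_mem_nhds one_pos)] with w hw
  -- `w - A = (1 - (z - w) R(z)) (z - A)`, and the first factor is inverted by a Neumann series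
  set U : (H →L[ℂ] H)ˣ := Units.oneSub ((z - w) • R) hw with hU
  have hUv : (U : H →L[ℂ] H) = 1 - (z - w) • R := rfl
  have hcomm : Commute (↑U⁻¹ : H →L[ℂ] H) R := by
    apply Commute.units_inv_left
    rw [hUv]
    exact (Commute.one_left R).sub_left ((Commute.refl R).smul_left _)
  refine ⟨R * (↑U⁻¹ : H →L[ℂ] H), fun v => ?_, fun u => ?_⟩
  · obtain ⟨h1, h2⟩ := hRz.1 ((↑U⁻¹ : H →L[ℂ] H) v)
    refine ⟨h1, ?_⟩
    set y := (↑U⁻¹ : H →L[ℂ] H) v with hy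
    have h3 : (U : H →L[ℂ] H) y = v := by
      rw [hy, ← mul_apply_eq_comp, Units.mul_inv]; rfl
    rw [hUv] at h3
    simp only [sub_apply, one_apply_eq_self,
      smul_apply] at h3
    change w • R y - A ⟨R y, h1⟩ = v
    have h4 : z • R y - A ⟨R y, h1⟩ = y := h2
    rw [← h3, ← sub_eq_zero]
    nth_rewrite 3 [← h4]
    rw [sub_smul]
    abel
  · have h3 : R (w • (u : H) - A u) = (U : H →L[ℂ] H) u := by
      rw [hR, resolvent_apply_sub hz u, ← hR, hUv]
      simp only [sub_apply, one_apply_eq_self,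
        smul_apply, sub_smul]
      abel
    rw [← hcomm.eq, mul_apply_eq_comp, h3, ← mul_apply_eq_comp,
      Units.inv_mul]
    rfl

theorem continuousAt_resolvent [CompleteSpace H] (hz : z ∈ resolventSet A) :
    ContinuousAt (resolvent A) z := by
  set C := ‖resolvent A z‖
  have h0 : ∀ᶠ w in 𝓝 z, w ∈ resolventSet A := (isOpen_resolventSet A).mem_nhds hz
  have hlim : Tendsto (fun w : ℂ => ‖z - w‖ * C) (𝓝 z) (𝓝 0) := by
    have : Continuous fun w : ℂ => ‖z - w‖ * C := by fun_prop
    simpa using this.tendsto z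
  have h1 : ∀ᶠ w in 𝓝 z, ‖z - w‖ * C < 1 / 2 := hlim.eventually (gt_mem_nhds (by norm_num))
  rw [ContinuousAt, tendsto_iff_norm_sub_tendsto_zero]
  have hlim2 : Tendsto (fun w : ℂ => 2 * C * (‖z - w‖ * C)) (𝓝 z) (𝓝 0) := by
    simpa using hlim.const_mul (2 * C)
  refine squeeze_zero' (Eventually.of_forall fun _ => norm_nonneg _) ?_ hlim2
  filter_upwards [h0, h1] with w hw hw1
  have h2 : ‖resolvent A w - resolvent A z‖ ≤ ‖z - w‖ * (‖resolvent A w‖ * C) := by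
    rw [resolvent_sub_resolvent hz hw, norm_smul]
    gcongr
    exact ContinuousLinearMap.opNorm_comp_le _ _
  have h3 : ‖resolvent A w‖ ≤ 2 * C := by
    have := norm_le_norm_add_norm_sub' (resolvent A w) (resolvent A z)
    nlinarith [norm_nonneg (resolvent A w)]
  have h4 : 0 ≤ ‖z - w‖ * C := by positivity
  nlinarith

theorem hasDerivAt_resolvent [CompleteSpace H] (hz : z ∈ resolventSet A) :
    HasDerivAt (resolvent A) (-(resolvent A z ∘L resolvent A z)) z := by
  rw [hasDerivAt_iff_tendsto_slope]
  have hc : ContinuousAt (fun w => -(resolvent A w ∘L resolvent A z)) z :=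
    ((continuousAt_resolvent hz).clm_comp continuousAt_const).neg
  refine (hc.tendsto.mono_left nhdsWithin_le_nhds).congr' ?_
  filter_upwards [self_mem_nhdsWithin, mem_nhdsWithin_of_mem_nhds
    ((isOpen_resolventSet A).mem_nhds hz)] with w hwz hw
  rw [slope_def_module, resolvent_sub_resolvent hz hw, smul_smul, ← neg_sub w z, mul_neg,
    inv_mul_cancel₀ (sub_ne_zero.2 hwz), neg_one_smul]

/-- An operator `X` vanishes if `z ↦ (z - A)⁻¹ X` extends to an entire function that tends to `0`
at infinity. The extension is given by `T` on the open set `U`, and by `T'` on `U'`. -/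
theorem eq_zero_of_resolvent_comp_extends [CompleteSpace H] (hρ : (resolventSet A).Nonempty)
    {U U' : Set ℂ} (hU : IsOpen U) (hU' : IsOpen U') (hd : Disjoint U U')
    (hσ : spectrum A ⊆ U ∪ U') (hb : Bornology.IsBounded U'ᶜ) {T T' : ℂ → H →L[ℂ] H}
    {X : H →L[ℂ] H} (hT : DifferentiableOn ℂ T U) (hT' : DifferentiableOn ℂ T' U')
    (hTX : ∀ z ∈ U, z ∈ resolventSet A → T z = resolvent A z ∘L X)
    (hTX' : ∀ z ∈ U', z ∈ resolventSet A → T' z = resolvent A z ∘L X)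
    (hlim : Tendsto T' (cocompact ℂ) (𝓝 0)) : X = 0 := by
  classical
  set G : ℂ → H →L[ℂ] H := fun z => if z ∈ resolventSet A then resolvent A z ∘L X
    else if z ∈ U then T z else T' z with hG
  have hGU : ∀ z ∈ U, G z = T z := fun z hz => by
    by_cases h : z ∈ resolventSet A
    · simp [hG, h, hTX z hz h]
    · simp [hG, h, hz]
  have hGU' : ∀ z ∈ U', G z = T' z := fun z hz => by
    by_cases h : z ∈ resolventSet A
    · simp [hG, h, hTX' z hz h]
    · simp [hG, h, hd.notMem_of_mem_right hz]
  have hGd : Differentiable ℂ G := by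
    intro z
    by_cases h : z ∈ resolventSet A
    · have h1 : DifferentiableAt ℂ (fun z => resolvent A z ∘L X) z :=
        (hasDerivAt_resolvent h).differentiableAt.clm_comp (differentiableAt_const _)
      refine h1.congr_of_eventuallyEq ?_
      filter_upwards [(isOpen_resolventSet A).mem_nhds h] with w hw
      simp [hG, hw]
    · rcases hσ h with hz | hz
      · exact (hT.differentiableAt (hU.mem_nhds hz)).congr_of_eventuallyEq
          (eventually_of_mem (hU.mem_nhds hz) hGU)
      · exact (hT'.differentiableAt (hU'.mem_nhds hz)).congr_of_eventuallyEq
          (eventually_of_mem (hU'.mem_nhds hz) hGU')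
  have hGlim : Tendsto G (cocompact ℂ) (𝓝 0) := by
    refine hlim.congr' ?_
    rw [← Metric.cobounded_eq_cocompact]
    filter_upwards [Bornology.isCobounded_def.1 (Bornology.isBounded_compl_iff.1 hb)] with z hz
    exact (hGU' z hz).symm
  obtain ⟨z, hz⟩ := hρ
  have h0 : G z = 0 := hGd.apply_eq_of_tendsto_cocompact z hGlim
  simp only [hG, hz, if_true] at h0
  ext v
  refine resolvent_injective hz ?_
  simpa using congrArg (fun B : H →L[ℂ] H => B v) h0

end UnboundedOperator

/-! ### The semigroup, its generator and its orbits -/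

namespace C0Semigroup

variable {H : Type*} [NormedAddCommGroup H] [NormedSpace ℂ H] (S : C0Semigroup H)

theorem hasGenerator_generator (v : S.generator.domain) :
    S.HasGenerator (v : H) (S.generator v) :=
  Classical.choose_spec v.2

variable {S} in
theorem HasGenerator.exists_generator_eq {v w : H} (h : S.HasGenerator v w) :
    ∃ hv : v ∈ S.generator.domain, S.generator ⟨v, hv⟩ = w :=
  ⟨⟨w, h⟩, (S.hasGenerator_generator ⟨v, ⟨w, h⟩⟩).unique h⟩

theorem toFun_comm {s t : ℝ} (hs : 0 ≤ s) (ht : 0 ≤ t) (v : H) :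
    S.toFun s (S.toFun t v) = S.toFun t (S.toFun s v) := by
  have h1 := S.map_add s t hs ht
  have h2 := S.map_add t s ht hs
  rw [add_comm, h1] at h2
  exact congrArg (fun B : H →L[ℂ] H => B v) h2

variable {S} in
theorem HasGenerator.toFun_apply {v w : H} (h : S.HasGenerator v w) {t : ℝ} (ht : 0 ≤ t) :
    S.HasGenerator (S.toFun t v) (S.toFun t w) := by
  refine (((S.toFun t).continuous.tendsto w).comp h).congr' ?_
  filter_upwards [self_mem_nhdsWithin] with s hs
  simp only [Function.comp_apply, map_smul, map_sub]
  rw [S.toFun_comm ht (le_of_lt hs)]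

theorem toFun_comp_resolvent {z : ℂ} (hz : z ∈ UnboundedOperator.resolventSet S.generator) {t : ℝ}
    (ht : 0 ≤ t) :
    S.toFun t ∘L UnboundedOperator.resolvent S.generator z =
      UnboundedOperator.resolvent S.generator z ∘L S.toFun t := by
  ext v
  have hR := UnboundedOperator.isResolventAt_resolvent hz
  obtain ⟨h1, h2⟩ := hR.1 v
  obtain ⟨h3, h4⟩ := ((S.hasGenerator_generator ⟨_, h1⟩).toFun_apply ht).exists_generator_eq
  have h5 := hR.2 ⟨_, h3⟩
  rw [h4, ← map_smul (S.toFun t), ← map_sub (S.toFun t), h2] at h5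
  exact h5.symm

/-- The orbit `t ↦ S t u`, extended to negative times by the constant `u`, which makes it
continuous on `ℝ`. -/
def orbit (u : H) (t : ℝ) : H := S.toFun (max t 0) u

theorem orbit_of_nonneg (u : H) {t : ℝ} (ht : 0 ≤ t) : S.orbit u t = S.toFun t u := by
  rw [orbit, max_eq_left ht]

theorem continuous_orbit (u : H) : Continuous (S.orbit u) :=
  (S.strongly_continuous u).comp_continuous (by fun_prop) fun t => le_max_right t 0

/-- The Laplace transform of the orbit of `u`, truncated at time `t`. -/
noncomputable def truncatedLaplace (z : ℂ) (u : H) (t : ℝ) : H :=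
  ∫ s in (0 : ℝ)..t, Complex.exp (-z * s) • S.orbit u s

theorem continuous_exp_smul_orbit (z : ℂ) (u : H) :
    Continuous fun s : ℝ => Complex.exp (-z * s) • S.orbit u s :=
  Continuous.smul (by fun_prop) (S.continuous_orbit u)

theorem hasDerivAt_truncatedLaplace [CompleteSpace H] (z : ℂ) (u : H) (t : ℝ) :
    HasDerivAt (S.truncatedLaplace z u) (Complex.exp (-z * t) • S.orbit u t) t :=
  (S.continuous_exp_smul_orbit z u).integral_hasStrictDerivAt 0 t |>.hasDerivAt

theorem toFun_truncatedLaplace [CompleteSpace H] (z : ℂ) (u : H) {h t : ℝ} (hh : 0 ≤ h)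
    (ht : 0 ≤ t) :
    S.toFun h (S.truncatedLaplace z u t) = Complex.exp (z * h) •
      (S.truncatedLaplace z u (t + h) - S.truncatedLaplace z u h) := by
  have hint : ∀ a b : ℝ, IntervalIntegrable (fun s : ℝ => Complex.exp (-z * s) • S.orbit u s)
      MeasureTheory.volume a b := fun a b =>
    (S.continuous_exp_smul_orbit z u).intervalIntegrable a b
  rw [truncatedLaplace, truncatedLaplace, truncatedLaplace,
    intervalIntegral.integral_interval_sub_left (hint _ _) (hint _ _),
    ← ContinuousLinearMap.intervalIntegral_comp_comm _ (hint _ _), ← intervalIntegral.integral_smul]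
  have hshift := intervalIntegral.integral_comp_add_right (a := 0) (b := t)
    (fun s : ℝ => Complex.exp (z * h) • Complex.exp (-z * s) • S.orbit u s) h
  rw [zero_add] at hshift
  rw [← hshift]
  refine intervalIntegral.integral_congr fun s hs => ?_
  rw [uIcc_of_le ht] at hs
  rw [map_smul, S.orbit_of_nonneg u hs.1, S.orbit_of_nonneg u (add_nonneg hs.1 hh), add_comm s h,
    S.map_add h s hh hs.1, smul_smul, ← Complex.exp_add]
  congr 2
  push_cast
  ring

theorem hasGenerator_truncatedLaplace [CompleteSpace H] (z : ℂ) (u : H) {t : ℝ} (ht : 0 ≤ t) :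
    S.HasGenerator (S.truncatedLaplace z u t)
      (z • S.truncatedLaplace z u t - (u - Complex.exp (-z * t) • S.toFun t u)) := by
  set K := S.truncatedLaplace z u with hK
  have hK0 : K 0 = 0 := by simp [hK, truncatedLaplace]
  have h1 : HasDerivAt (fun h : ℝ => Complex.exp (z * h)) z 0 := by
    have : HasDerivAt (fun h : ℝ => Complex.exp (z * (h : ℂ)))
      (Complex.exp (z * (0 : ℝ)) * (z * 1)) 0 :=
        ((Complex.ofRealCLM.hasDerivAt (x := 0)).const_mul z).cexp
    simpa using this
  have h2 : HasDerivAt (fun h : ℝ => K (t + h) - K h)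
      (Complex.exp (-z * t) • S.toFun t u - u) 0 := by
    have h3 : HasDerivAt (fun h : ℝ => K (t + h)) (Complex.exp (-z * t) • S.toFun t u) 0 := by
      have := S.hasDerivAt_truncatedLaplace z u t
      rw [S.orbit_of_nonneg u ht] at this
      rw [← add_zero t] at this
      simpa using this.comp_const_add t 0
    have h4 : HasDerivAt K u 0 := by
      simpa [S.orbit_of_nonneg u le_rfl, S.map_zero] using S.hasDerivAt_truncatedLaplace z u 0
    exact h3.sub h4
  have h5 := (h1.smul h2).hasDerivWithinAt (s := Ioi 0)
  rw [hasDerivWithinAt_iff_tendsto_slope' self_notMem_Ioi] at h5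
  have h6 : Complex.exp (z * (0 : ℝ)) • (Complex.exp (-z * t) • S.toFun t u - u) +
      z • (K (t + 0) - K 0) = z • K t - (u - Complex.exp (-z * t) • S.toFun t u) := by
    simp [hK0]
    abel
  rw [h6] at h5
  refine h5.congr' ?_
  filter_upwards [self_mem_nhdsWithin] with h hh
  rw [slope_def_module, S.toFun_truncatedLaplace z u (le_of_lt hh) ht]
  simp only [Pi.smul_apply', add_zero, sub_zero, hK0, ← Complex.ofReal_inv,
    Complex.coe_smul, Complex.ofReal_zero, mul_zero, Complex.exp_zero, one_smul, ← hK]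

/-- A semigroup that is locally bounded near `0` grows at most exponentially. -/
theorem exists_norm_toFun_le_exp {m : ℝ → ℝ} (hm_cont : ContinuousOn m (Ici 0))
    (hm : ∀ t, 0 ≤ t → ‖S.toFun t‖ ≤ m t) :
    ∃ M c : ℝ, ∀ t, 0 ≤ t → ‖S.toFun t‖ ≤ M * Real.exp (c * t) := by
  obtain ⟨B, hB⟩ := (isCompact_Icc (a := (0 : ℝ)) (b := 1)).bddAbove_image
    (hm_cont.mono Icc_subset_Ici_self)
  set M := max B 1 with hM
  have hM1 : 1 ≤ M := le_max_right _ _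
  have h01 : ∀ t ∈ Icc (0 : ℝ) 1, ‖S.toFun t‖ ≤ M := fun t ht =>
    (hm t ht.1).trans ((hB (mem_image_of_mem m ht)).trans (le_max_left _ _))
  have hn : ∀ (n : ℕ), ∀ t ∈ Icc (0 : ℝ) 1, ‖S.toFun (t + n)‖ ≤ M * M ^ n := by
    intro n
    induction n with
    | zero => simpa using h01
    | succ n ih =>
      intro t ht
      have : t + (n + 1 : ℕ) = 1 + (t + n) := by push_cast; ring
      rw [this, S.map_add 1 (t + n) zero_le_one (by have := ht.1; positivity)]
      refine (ContinuousLinearMap.opNorm_comp_le _ _).trans ?_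
      calc ‖S.toFun 1‖ * ‖S.toFun (t + n)‖ ≤ M * (M * M ^ n) := by
            gcongr
            · exact h01 1 (by simp)
            · exact ih t ht
        _ = M * M ^ (n + 1) := by ring
  refine ⟨M, Real.log M, fun t ht => ?_⟩
  have h1 := hn ⌊t⌋₊ (t - ⌊t⌋₊) ⟨sub_nonneg.2 (Nat.floor_le ht), by
    linarith [Nat.lt_floor_add_one t]⟩
  rw [sub_add_cancel] at h1
  refine h1.trans ?_
  gcongr
  rw [← Real.rpow_natCast, ← Real.rpow_def_of_pos (by positivity)]
  exact Real.rpow_le_rpow_of_exponent_le hM1 (Nat.floor_le ht)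

end C0Semigroup

/-! ### Cauchy integrals along families of closed curves -/

section CauchyIntegral

open MeasureTheory

variable {E : Type*} [NormedAddCommGroup E] [NormedSpace ℂ E]

theorem hasDerivAt_integral_inv_sub_smul {γ : ℝ → ℂ} (hγ : Continuous γ) {g : ℝ → E}
    (hg : Continuous g) {a b : ℝ} {w : ℂ} (hw : ∀ t ∈ uIcc a b, γ t ≠ w) :
    HasDerivAt (fun w => ∫ t in a..b, (γ t - w)⁻¹ • g t)
      (∫ t in a..b, ((γ t - w) ^ 2)⁻¹ • g t) w := by
  obtain ⟨r, hr, hrt⟩ : ∃ r > 0, ∀ t ∈ uIcc a b, r ≤ ‖γ t - w‖ := by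
    obtain ⟨t₀, ht₀, hmin⟩ := isCompact_uIcc.exists_isMinOn nonempty_uIcc
      (f := fun t => ‖γ t - w‖) (by fun_prop)
    exact ⟨_, norm_pos_iff.2 (sub_ne_zero.2 (hw t₀ ht₀)), fun t ht => hmin ht⟩
  have hball : ∀ t ∈ uIcc a b, ∀ x ∈ Metric.ball w (r / 2), r / 2 ≤ ‖γ t - x‖ := by
    intro t ht x hx
    have h1 := hrt t ht
    have h2 : ‖x - w‖ < r / 2 := by simpa [dist_eq_norm] using hx
    have h3 : ‖γ t - w‖ ≤ ‖γ t - x‖ + ‖x - w‖ := norm_sub_le_norm_sub_add_norm_sub _ _ _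
    linarith
  have hne : ∀ t ∈ uIcc a b, ∀ x ∈ Metric.ball w (r / 2), γ t - x ≠ 0 := fun t ht x hx =>
    norm_pos_iff.1 (by linarith [hball t ht x hx])
  have hcont : ∀ x ∈ Metric.ball w (r / 2), ContinuousOn (fun t => (γ t - x)⁻¹ • g t)
      (uIcc a b) := fun x hx =>
    ((hγ.sub continuous_const).continuousOn.inv₀ fun t ht => hne t ht x hx).smul hg.continuousOn
  have hmem : Metric.ball w (r / 2) ∈ 𝓝 w := Metric.ball_mem_nhds _ (by positivity)
  have hmeas : ∀ {f : ℝ → E}, ContinuousOn f (uIcc a b) →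
      AEStronglyMeasurable f (volume.restrict (uIoc a b)) := fun hf =>
    (hf.mono uIoc_subset_uIcc).aestronglyMeasurable measurableSet_uIoc
  refine (intervalIntegral.hasDerivAt_integral_of_dominated_loc_of_deriv_le
    (F := fun w t => (γ t - w)⁻¹ • g t) (F' := fun w t => ((γ t - w) ^ 2)⁻¹ • g t)
    (bound := fun t => ((r / 2) ^ 2)⁻¹ * ‖g t‖) hmem
    ?_ ?_ ?_ ?_ ?_ ?_).2
  · filter_upwards [hmem] with x hx using hmeas (hcont x hx)
  · exact (hcont w (mem_of_mem_nhds hmem)).intervalIntegrable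
  · refine hmeas (ContinuousOn.smul (ContinuousOn.inv₀ (by fun_prop) fun t ht => ?_)
      hg.continuousOn)
    exact pow_ne_zero 2 (hne t ht w (mem_of_mem_nhds hmem))
  · refine Eventually.of_forall fun t ht x hx => ?_
    rw [norm_smul, norm_inv, norm_pow]
    have := hball t (uIoc_subset_uIcc ht) x hx
    gcongr
  · exact Continuous.intervalIntegrable (by fun_prop) _ _
  · refine Eventually.of_forall fun t ht x hx => ?_
    have h1 := ((hasDerivAt_id x).const_sub (γ t)).inv (hne t (uIoc_subset_uIcc ht) x hx)
    simpa using h1.smul_const (g t)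

theorem tendsto_integral_inv_sub_smul_cocompact {γ : ℝ → ℂ} (hγ : Continuous γ) {g : ℝ → E}
    (hg : Continuous g) (a b : ℝ) :
    Tendsto (fun w => ∫ t in a..b, (γ t - w)⁻¹ • g t) (cocompact ℂ) (𝓝 0) := by
  obtain ⟨B, hB⟩ := isCompact_uIcc.exists_bound_of_continuousOn (hγ.continuousOn (s := uIcc a b))
  obtain ⟨K, hK⟩ := isCompact_uIcc.exists_bound_of_continuousOn (hg.continuousOn (s := uIcc a b))
  have hK0 : 0 ≤ K := (norm_nonneg _).trans (hK a left_mem_uIcc)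
  have h1 : Tendsto (fun w : ℂ => ‖w‖ - B) (cocompact ℂ) atTop :=
    tendsto_atTop_add_const_right _ (-B) tendsto_norm_cocompact_atTop
  have h2 : Tendsto (fun w : ℂ => (‖w‖ - B)⁻¹ * K * |b - a|) (cocompact ℂ) (𝓝 0) := by
    simpa using (h1.inv_tendsto_atTop.mul_const K).mul_const |b - a|
  refine squeeze_zero_norm' ?_ h2
  filter_upwards [h1.eventually_gt_atTop 0] with w hw
  refine intervalIntegral.norm_integral_le_of_norm_le_const fun t ht => ?_
  have ht' := uIoc_subset_uIcc ht
  rw [norm_smul, norm_inv]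
  have h3 : ‖w‖ - B ≤ ‖γ t - w‖ := by
    have := norm_sub_norm_le w (γ t)
    rw [norm_sub_rev] at this
    linarith [hB t ht']
  have := hK t ht'
  gcongr

/-- The Cauchy integral `w ↦ (2πi)⁻¹ ∑ⱼ ∫_{γⱼ} f(z) / (z - w) dz` of a function `f` along a family
of closed curves, each parametrized over a period `[0, 1]`. -/
noncomputable def contourCauchyIntegral {n : ℕ} (γ : Fin n → ℝ → ℂ) (f : ℂ → E) (w : ℂ) : E :=
  (2 * (Real.pi : ℂ) * Complex.I)⁻¹ •
    ∑ j, ∫ t in (0 : ℝ)..1, (γ j t - w)⁻¹ • deriv (γ j) t • f (γ j t)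

variable {n : ℕ} {γ : Fin n → ℝ → ℂ}

theorem continuous_deriv_smul_comp (hγ : ∀ j, ContDiff ℝ 1 (γ j)) {f : ℂ → E}
    (hf : ContinuousOn f (⋃ j, range (γ j))) (j : Fin n) :
    Continuous fun t => deriv (γ j) t • f (γ j t) :=
  ((hγ j).continuous_deriv le_rfl).smul (hf.comp_continuous (hγ j).continuous
    fun t => mem_iUnion.2 ⟨j, mem_range_self t⟩)

theorem hasDerivAt_contourCauchyIntegral (hγ : ∀ j, ContDiff ℝ 1 (γ j)) {f : ℂ → E}
    (hf : ContinuousOn f (⋃ j, range (γ j))) {w : ℂ} (hw : w ∉ ⋃ j, range (γ j)) :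
    HasDerivAt (contourCauchyIntegral γ f) ((2 * (Real.pi : ℂ) * Complex.I)⁻¹ •
      ∑ j, ∫ t in (0 : ℝ)..1, ((γ j t - w) ^ 2)⁻¹ • deriv (γ j) t • f (γ j t)) w := by
  refine HasDerivAt.const_smul _ (HasDerivAt.fun_sum fun j _ => ?_)
  refine hasDerivAt_integral_inv_sub_smul (hγ j).continuous (continuous_deriv_smul_comp hγ hf j)
    fun t _ h => hw (mem_iUnion.2 ⟨j, t, h⟩)

theorem tendsto_contourCauchyIntegral_cocompact (hγ : ∀ j, ContDiff ℝ 1 (γ j)) {f : ℂ → E}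
    (hf : ContinuousOn f (⋃ j, range (γ j))) :
    Tendsto (contourCauchyIntegral γ f) (cocompact ℂ) (𝓝 0) := by
  have := (tendsto_finsetSum (Finset.univ : Finset (Fin n)) fun j _ =>
    tendsto_integral_inv_sub_smul_cocompact (hγ j).continuous
      (continuous_deriv_smul_comp hγ hf j) 0 1).const_smul (2 * (Real.pi : ℂ) * Complex.I)⁻¹
  simp only [Finset.sum_const_zero, smul_zero] at this
  exact this

/-- The index of a family of closed curves is locally constant off the curves. -/
theorem hasDerivAt_contourCauchyIntegral_one (hγ : ∀ j, ContDiff ℝ 1 (γ j))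
    (hper : ∀ j, Function.Periodic (γ j) 1) {w : ℂ} (hw : w ∉ ⋃ j, range (γ j)) :
    HasDerivAt (contourCauchyIntegral γ fun _ => (1 : ℂ)) 0 w := by
  have h := hasDerivAt_contourCauchyIntegral hγ (f := fun _ => (1 : ℂ)) continuousOn_const hw
  have h0 : ∀ j, ∫ t in (0 : ℝ)..1, ((γ j t - w) ^ 2)⁻¹ • deriv (γ j) t • (1 : ℂ) = 0 := by
    intro j
    have hne : ∀ t, γ j t - w ≠ 0 := fun t h => hw (mem_iUnion.2 ⟨j, t, sub_eq_zero.1 h⟩)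
    have hd : ∀ t, HasDerivAt (fun t => -(γ j t - w)⁻¹)
        (((γ j t - w) ^ 2)⁻¹ • deriv (γ j) t • (1 : ℂ)) t := by
      intro t
      have := (((((hγ j).differentiable one_ne_zero) t).hasDerivAt.sub_const w).inv (hne t)).neg
      convert! this using 1
      simp [div_eq_mul_inv, mul_comm]
    rw [intervalIntegral.integral_eq_sub_of_hasDerivAt (fun t _ => hd t)]
    · have := hper j 0
      rw [zero_add] at this
      rw [this, sub_self]
    · refine Continuous.intervalIntegrable ?_ _ _
      refine Continuous.smul (Continuous.inv₀ ?_ fun t => pow_ne_zero 2 (hne t)) ?_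
      · have := (hγ j).continuous
        fun_prop
      · exact ((hγ j).continuous_deriv le_rfl).smul continuous_const
  simpa only [h0, Finset.sum_const_zero, smul_zero] using h

end CauchyIntegral

/-! ### The jump of a Cauchy integral across an arc -/

section Index

/-- In the coordinate `(γ - γ t₀) / γ' t₀` a regular `C¹` curve is close to the real axis near
`t₀`. -/
theorem exists_norm_div_deriv_sub_le {γ : ℝ → ℂ} (hγ : ContDiff ℝ 1 γ) {t₀ : ℝ}
    (hd : deriv γ t₀ ≠ 0) :
    ∃ η : ℝ, 0 < η ∧ η < 1 / 2 ∧ ∀ s ∈ Icc (t₀ - η) (t₀ + η), ∀ t ∈ Icc (t₀ - η) (t₀ + η),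
      ‖(γ t - γ s) / deriv γ t₀ - ((t - s : ℝ) : ℂ)‖ ≤ 1 / 2 * |t - s| := by
  have h1 : HasStrictDerivAt γ (deriv γ t₀) t₀ :=
    hγ.contDiffAt.hasStrictDerivAt one_ne_zero
  have h2 := h1.div_const (deriv γ t₀)
  rw [div_self hd] at h2
  have h3 := h2.hasStrictFDerivAt.isLittleO.def (by norm_num : (0 : ℝ) < 1 / 2)
  obtain ⟨r, hr, hball⟩ := Metric.eventually_nhds_iff_ball.1 h3
  refine ⟨min (r / 2) (1 / 4), by positivity, by
    have := min_le_right (r / 2) (1 / 4 : ℝ); linarith, fun s hs t ht => ?_⟩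
  have hmem : ∀ x ∈ Icc (t₀ - min (r / 2) (1 / 4)) (t₀ + min (r / 2) (1 / 4)), dist x t₀ < r := by
    intro x hx
    have := min_le_left (r / 2) (1 / 4 : ℝ)
    rw [Real.dist_eq, abs_lt]
    constructor <;> linarith [hx.1, hx.2]
  have := hball (t, s) (by
    rw [← ball_prod_same]; exact ⟨hmem t ht, hmem s hs⟩)
  simpa [sub_div, Real.norm_eq_abs] using this

theorem tendsto_log_add_sub_log_neg_add {z : ℂ} (hz : z.im ≠ 0) :
    Tendsto (fun ε : ℝ => Complex.log (z + ε) - Complex.log (-z + ε)) (𝓝[>] 0)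
      (𝓝 (Complex.log z - Complex.log (-z))) := by
  refine Tendsto.mono_left ?_ nhdsWithin_le_nhds
  have h1 : ContinuousAt (fun ε : ℝ => Complex.log (z + ε) - Complex.log (-z + ε)) 0 :=
    ContinuousAt.sub
      (ContinuousAt.clog (by fun_prop) (Or.inr (by simpa using hz)))
      (ContinuousAt.clog (by fun_prop) (Or.inr (by simpa using hz)))
  simpa using h1.tendsto

theorem integral_inv_mul_deriv_eq_log {γ : ℝ → ℂ} (hγ : ContDiff ℝ 1 γ) {a b : ℝ} {w e : ℂ}
    (he : e ≠ 0) (h : ∀ t ∈ uIcc a b, e * (γ t - w) ∈ Complex.slitPlane) :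
    ∫ t in a..b, (γ t - w)⁻¹ • deriv γ t • (1 : ℂ) =
      Complex.log (e * (γ b - w)) - Complex.log (e * (γ a - w)) := by
  have hne : ∀ t ∈ uIcc a b, γ t - w ≠ 0 := fun t ht h0 => by
    have := h t ht
    simp [h0] at this
  refine intervalIntegral.integral_eq_sub_of_hasDerivAt
    (f := fun t => Complex.log (e * (γ t - w))) (fun t ht => ?_) ?_
  · have h1 := (((hγ.differentiable one_ne_zero) t).hasDerivAt.sub_const w).const_mul e
    have h2 := h1.clog_real (h t ht)
    convert! h2 using 1
    have := hne t ht
    simp only [smul_eq_mul, mul_one]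
    field_simp
  · refine ContinuousOn.intervalIntegrable (ContinuousOn.smul (ContinuousOn.inv₀ ?_ hne) ?_)
    · exact (hγ.continuous.sub continuous_const).continuousOn
    · exact ((hγ.continuous_deriv le_rfl).smul continuous_const).continuousOn

/-- The jump of the Cauchy integral of `1` across a short arc that crosses the line
`γ t₀ + i ℝ γ' t₀` only at `γ t₀`: on either side the integrand has a logarithm as a primitive,
with branch cuts on opposite halves of that line. -/
theorem tendsto_jump_integral_inv {γ : ℝ → ℂ} (hγ : ContDiff ℝ 1 γ) {t₀ η : ℝ} (hη : 0 < η)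
    (hd : deriv γ t₀ ≠ 0)
    (hpos : ∀ t ∈ Ioc t₀ (t₀ + η), 0 < ((γ t - γ t₀) / deriv γ t₀).re)
    (hneg : ∀ t ∈ Ico (t₀ - η) t₀, ((γ t - γ t₀) / deriv γ t₀).re < 0) :
    Tendsto (fun ε : ℝ =>
      (∫ t in (t₀ - η)..(t₀ + η), (γ t - (γ t₀ + ε * (Complex.I * deriv γ t₀)))⁻¹ •
        deriv γ t • (1 : ℂ)) -
      ∫ t in (t₀ - η)..(t₀ + η), (γ t - (γ t₀ - ε * (Complex.I * deriv γ t₀)))⁻¹ •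
        deriv γ t • (1 : ℂ)) (𝓝[>] 0) (𝓝 (2 * Real.pi * Complex.I)) := by
  set d := deriv γ t₀ with hdd
  set q : ℝ → ℂ := fun t => (γ t - γ t₀) / d with hq
  have hslit : ∀ t ∈ uIcc (t₀ - η) (t₀ + η), ∀ ε : ℝ, 0 < ε →
      Complex.I * q t + ε ∈ Complex.slitPlane ∧ -(Complex.I * q t) + ε ∈ Complex.slitPlane := by
    intro t ht ε hε
    rw [uIcc_of_le (by linarith)] at ht
    rcases lt_trichotomy t t₀ with h | h | h
    · have := hneg t ⟨ht.1, h⟩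
      constructor <;> refine Or.inr ?_ <;> simpa using this.ne
    · constructor <;> refine Or.inl ?_ <;> simpa [hq, h] using hε
    · have := hpos t ⟨h, ht.2⟩
      constructor <;> refine Or.inr ?_ <;> simpa using this.ne'
  have e1 : ∀ (t ε : ℝ), Complex.I / d * (γ t - (γ t₀ + ε * (Complex.I * d))) =
      Complex.I * q t + ε := fun t ε => by
    simp only [hq]
    field_simp
    linear_combination (-(ε : ℂ) * d) * Complex.I_sq
  have e2 : ∀ (t ε : ℝ), -Complex.I / d * (γ t - (γ t₀ - ε * (Complex.I * d))) =
      -(Complex.I * q t) + ε := fun t ε => by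
    simp only [hq]
    field_simp
    linear_combination (-(ε : ℂ) * d) * Complex.I_sq
  have h2 : 0 < (Complex.I * q (t₀ + η)).im := by
    simpa using hpos (t₀ + η) ⟨by linarith, le_rfl⟩
  have h1 : (Complex.I * q (t₀ - η)).im < 0 := by
    simpa using hneg (t₀ - η) ⟨le_rfl, by linarith⟩
  have l2 : Complex.log (Complex.I * q (t₀ + η)) - Complex.log (-(Complex.I * q (t₀ + η))) =
      Real.pi * Complex.I := by
    simp only [Complex.log, norm_neg, Complex.arg_neg_eq_arg_sub_pi_of_im_pos h2]
    push_cast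
    ring
  have l1 : Complex.log (Complex.I * q (t₀ - η)) - Complex.log (-(Complex.I * q (t₀ - η))) =
      -(Real.pi * Complex.I) := by
    simp only [Complex.log, norm_neg, Complex.arg_neg_eq_arg_add_pi_of_im_neg h1]
    push_cast
    ring
  have hlim := (tendsto_log_add_sub_log_neg_add h2.ne').sub (tendsto_log_add_sub_log_neg_add h1.ne)
  rw [l1, l2] at hlim
  have : (Real.pi : ℂ) * Complex.I - -(Real.pi * Complex.I) = 2 * Real.pi * Complex.I := by ring
  rw [this] at hlim
  refine hlim.congr' ?_
  filter_upwards [self_mem_nhdsWithin] with ε hε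
  rw [integral_inv_mul_deriv_eq_log hγ (e := Complex.I / d) (div_ne_zero Complex.I_ne_zero hd)
      fun t ht => by rw [e1]; exact (hslit t ht ε hε).1,
    integral_inv_mul_deriv_eq_log hγ (e := -Complex.I / d)
      (div_ne_zero (neg_ne_zero.2 Complex.I_ne_zero) hd)
      fun t ht => by rw [e2]; exact (hslit t ht ε hε).2, e1, e1, e2, e2]
  ring

theorem tendsto_add_mul_nhds (p e : ℂ) : Tendsto (fun ε : ℝ => p + ε * e) (𝓝[>] 0) (𝓝 p) := by
  have : Continuous fun ε : ℝ => p + ε * e := by fun_prop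
  simpa using (this.tendsto 0).mono_left nhdsWithin_le_nhds

/-- The Cauchy integral of `1` has no jump at a point off the arc. -/
theorem tendsto_jump_integral_inv_of_notMem {γ : ℝ → ℂ} (hγ : ContDiff ℝ 1 γ) {a b : ℝ} {p : ℂ}
    (e : ℂ) (h : ∀ t ∈ uIcc a b, γ t ≠ p) :
    Tendsto (fun ε : ℝ => (∫ t in a..b, (γ t - (p + ε * e))⁻¹ • deriv γ t • (1 : ℂ)) -
      ∫ t in a..b, (γ t - (p - ε * e))⁻¹ • deriv γ t • (1 : ℂ)) (𝓝[>] 0) (𝓝 0) := by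
  have h1 := (hasDerivAt_integral_inv_sub_smul hγ.continuous
    (g := fun t => deriv γ t • (1 : ℂ))
    ((hγ.continuous_deriv le_rfl).smul continuous_const) h).continuousAt.tendsto
  have h2 := h1.comp (tendsto_add_mul_nhds p e)
  have h3 := h1.comp (tendsto_add_mul_nhds p (-e))
  simpa [Function.comp_def, sub_eq_add_neg] using h2.sub h3

end Index

/-! ### The jump of the index across an oriented boundary -/

namespace IsOrientedC1Boundary

variable {V : Set ℂ} {n : ℕ} {γ : Fin n → ℝ → ℂ}

theorem eq_add_int (hb : IsOrientedC1Boundary V γ) {j k : Fin n} {s t : ℝ} (h : γ j s = γ k t) :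
    j = k ∧ ∃ i : ℤ, s = t + i := by
  have hred : ∀ j s, γ j (Int.fract s) = γ j s := fun j s => by
    have := (hb.periodic j).sub_zsmul_eq ⌊s⌋ (x := s)
    rwa [zsmul_one, Int.self_sub_floor] at this
  have h1 := hb.simple_disjoint j k (Int.fract s) ⟨Int.fract_nonneg s, Int.fract_lt_one s⟩
    (Int.fract t) ⟨Int.fract_nonneg t, Int.fract_lt_one t⟩ (by rw [hred, hred, h])
  refine ⟨h1.1, ⌊s⌋ - ⌊t⌋, ?_⟩
  have h2 := h1.2
  have h3 := Int.fract_add_floor s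
  have h4 := Int.fract_add_floor t
  push_cast
  linarith

theorem ne_of_mem_Icc (hb : IsOrientedC1Boundary V γ) (j : Fin n) {t₀ η t : ℝ} (hη : 0 < η)
    (ht : t ∈ Icc (t₀ + η) (t₀ + 1 - η)) : γ j t ≠ γ j t₀ := by
  intro h
  obtain ⟨i, hi⟩ := (hb.eq_add_int h).2
  have h1 : (0 : ℝ) < i := by linarith [ht.1]
  have h2 : (i : ℝ) < 1 := by linarith [ht.2]
  norm_cast at h1 h2
  omega

theorem mem_frontier (hb : IsOrientedC1Boundary V γ) (j : Fin n) (t : ℝ) : γ j t ∈ frontier V := by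
  rw [← hb.iUnion_range]
  exact mem_iUnion.2 ⟨j, mem_range_self t⟩

/-- Near `γ j t₀` the boundary consists of the arc of `γ j` around `t₀` only, because the curves are
simple, disjoint and compact. -/
theorem eventually_exists_eq (hb : IsOrientedC1Boundary V γ) (j : Fin n) (t₀ : ℝ) {η : ℝ}
    (hη : 0 < η) :
    ∀ᶠ z in 𝓝 (γ j t₀), z ∈ frontier V → ∃ t ∈ Icc (t₀ - η) (t₀ + η), z = γ j t := by
  have hc1 : IsClosed (γ j '' Icc (t₀ + η) (t₀ + 1 - η)) :=
    (isCompact_Icc.image (hb.contDiff j).continuous).isClosed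
  have hc2 : IsClosed (⋃ k ∈ {k : Fin n | k ≠ j}, γ k '' Icc 0 1) :=
    (toFinite _).isClosed_biUnion fun k _ =>
      (isCompact_Icc.image (hb.contDiff k).continuous).isClosed
  have hn1 : γ j t₀ ∉ γ j '' Icc (t₀ + η) (t₀ + 1 - η) := by
    rintro ⟨t, ht, h⟩
    exact hb.ne_of_mem_Icc j hη ht h
  have hn2 : γ j t₀ ∉ ⋃ k ∈ {k : Fin n | k ≠ j}, γ k '' Icc 0 1 := by
    simp only [mem_iUnion, not_exists]
    rintro k hk ⟨t, _, h⟩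
    exact hk (hb.eq_add_int h).1
  filter_upwards [hc1.isOpen_compl.mem_nhds hn1, hc2.isOpen_compl.mem_nhds hn2] with z hz1 hz2 hz
  rw [← hb.iUnion_range] at hz
  obtain ⟨k, t, rfl⟩ := mem_iUnion.1 hz
  by_cases hk : k = j
  · subst hk
    obtain ⟨t', ht', h⟩ := (hb.periodic k).exists_mem_Ico one_pos t (t₀ - η)
    rw [h] at hz1 ⊢
    refine ⟨t', ⟨ht'.1, ?_⟩, rfl⟩
    by_contra hlt
    exact hz1 ⟨t', ⟨(not_le.1 hlt).le, by linarith [ht'.2]⟩, rfl⟩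
  · exfalso
    obtain ⟨t', ht', h⟩ := (hb.periodic k).exists_mem_Ico one_pos t 0
    rw [h] at hz2
    exact hz2 (mem_biUnion (show k ∈ {k | k ≠ j} from hk)
      ⟨t', ⟨ht'.1, by linarith [ht'.2]⟩, rfl⟩)

theorem eventually_notMem_frontier (hb : IsOrientedC1Boundary V γ) (hV : IsClosed V) (j : Fin n)
    (t₀ : ℝ) : ∀ᶠ ε : ℝ in 𝓝[>] 0,
      γ j t₀ + ε * (Complex.I * deriv (γ j) t₀) ∉ frontier V ∧
      γ j t₀ - ε * (Complex.I * deriv (γ j) t₀) ∉ frontier V := by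
  filter_upwards [hb.left_mem j t₀, hb.right_notMem j t₀] with ε h1 h2
  exact ⟨fun h => disjoint_interior_frontier.notMem_of_mem_left h1 h,
    fun h => h2 (hV.frontier_subset h)⟩

/-- The index of the oriented boundary jumps by one across each boundary point. -/
theorem tendsto_jump (hb : IsOrientedC1Boundary V γ) (hV : IsClosed V) (j : Fin n) (t₀ : ℝ) :
    Tendsto (fun ε : ℝ =>
      contourCauchyIntegral γ (fun _ => (1 : ℂ)) (γ j t₀ + ε * (Complex.I * deriv (γ j) t₀)) -
      contourCauchyIntegral γ (fun _ => (1 : ℂ)) (γ j t₀ - ε * (Complex.I * deriv (γ j) t₀)))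
      (𝓝[>] 0) (𝓝 1) := by
  classical
  set p := γ j t₀ with hp
  set e := Complex.I * deriv (γ j) t₀ with he
  have hsum : Tendsto (fun ε : ℝ => ∑ k,
      ((∫ t in (0 : ℝ)..1, (γ k t - (p + ε * e))⁻¹ • deriv (γ k) t • (1 : ℂ)) -
      ∫ t in (0 : ℝ)..1, (γ k t - (p - ε * e))⁻¹ • deriv (γ k) t • (1 : ℂ)))
      (𝓝[>] 0) (𝓝 (∑ k, if k = j then 2 * Real.pi * Complex.I else 0)) := by
    refine tendsto_finsetSum _ fun k _ => ?_
    split_ifs with hk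
    · subst hk
      have hd := hb.deriv_ne_zero k t₀
      obtain ⟨η, hη, hη2, hq⟩ := exists_norm_div_deriv_sub_le (hb.contDiff k) hd
      have hq' : ∀ t ∈ Icc (t₀ - η) (t₀ + η),
          |((γ k t - γ k t₀) / deriv (γ k) t₀).re - (t - t₀)| ≤ 1 / 2 * |t - t₀| := fun t ht => by
        have := (Complex.abs_re_le_norm _).trans (hq t₀ ⟨by linarith, by linarith⟩ t ht)
        simpa using this
      have j1 := tendsto_jump_integral_inv (hb.contDiff k) hη hd
        (fun t ht => by
          have := (abs_le.1 (hq' t ⟨by linarith [ht.1], ht.2⟩)).1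
          rw [abs_of_pos (by linarith [ht.1])] at this
          linarith [ht.1])
        (fun t ht => by
          have := (abs_le.1 (hq' t ⟨ht.1, by linarith [ht.2]⟩)).2
          rw [abs_of_neg (by linarith [ht.2])] at this
          linarith [ht.2])
      have j2 := tendsto_jump_integral_inv_of_notMem (hb.contDiff k) e (p := p)
        (a := t₀ + η) (b := t₀ - η + 1) fun t ht => hb.ne_of_mem_Icc k hη (by
          rw [uIcc_of_le (by linarith)] at ht
          exact ⟨ht.1, by linarith [ht.2]⟩)
      have hlim := j1.add j2
      rw [add_zero] at hlim
      refine hlim.congr' ?_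
      have hsplit : ∀ w ∉ frontier V,
          ∫ t in (0 : ℝ)..1, (γ k t - w)⁻¹ • deriv (γ k) t • (1 : ℂ) =
          (∫ t in (t₀ - η)..(t₀ + η), (γ k t - w)⁻¹ • deriv (γ k) t • (1 : ℂ)) +
          ∫ t in (t₀ + η)..(t₀ - η + 1), (γ k t - w)⁻¹ • deriv (γ k) t • (1 : ℂ) := by
        intro w hw
        have hne : ∀ t, γ k t - w ≠ 0 := fun t h => hw (by
          rw [← sub_eq_zero.1 h]; exact hb.mem_frontier k t)
        have hcont : Continuous fun t => (γ k t - w)⁻¹ • deriv (γ k) t • (1 : ℂ) :=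
          (((hb.contDiff k).continuous.sub continuous_const).inv₀ hne).smul
            (((hb.contDiff k).continuous_deriv le_rfl).smul continuous_const)
        have hper : Function.Periodic (fun t => (γ k t - w)⁻¹ • deriv (γ k) t • (1 : ℂ)) 1 := by
          intro t
          have h1 : deriv (γ k) (t + 1) = deriv (γ k) t := by
            rw [← deriv_comp_add_const, funext (hb.periodic k)]
          simp only [hb.periodic k t, h1]
        rw [intervalIntegral.integral_add_adjacent_intervals (hcont.intervalIntegrable _ _)
          (hcont.intervalIntegrable _ _), hper.intervalIntegral_add_eq (t₀ - η) 0, zero_add]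
      filter_upwards [hb.eventually_notMem_frontier hV k t₀] with ε hε
      rw [hsplit _ hε.1, hsplit _ hε.2]
      ring
    · refine tendsto_jump_integral_inv_of_notMem (hb.contDiff k) e fun t _ h => hk ?_
      exact (hb.eq_add_int h).1
  rw [Finset.sum_ite_eq' Finset.univ j, if_pos (Finset.mem_univ j)] at hsum
  have h2 := hsum.const_smul (2 * (Real.pi : ℂ) * Complex.I)⁻¹
  have hpi : (2 * (Real.pi : ℂ) * Complex.I) ≠ 0 := Complex.two_pi_I_ne_zero
  rw [smul_eq_mul, inv_mul_cancel₀ hpi] at h2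
  refine h2.congr fun ε => ?_
  simp only [contourCauchyIntegral, Finset.sum_sub_distrib, smul_sub]

end IsOrientedC1Boundary

/-! ### The index of an oriented boundary -/

theorem eq_of_hasDerivAt_zero_of_segment {s : Set ℂ} {h : ℂ → ℂ}
    (hder : ∀ w ∉ s, HasDerivAt h 0 w) {x y : ℂ}
    (hxy : ∀ θ ∈ Icc (0 : ℝ) 1, x + θ • (y - x) ∉ s) : h x = h y := by
  have hseg : ∀ w ∈ segment ℝ x y, w ∉ s := by
    rw [segment_eq_image']
    rintro _ ⟨θ, hθ, rfl⟩
    exact hxy θ hθ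
  have := (convex_segment x y).norm_image_sub_le_of_norm_hasDerivWithin_le (C := 0)
    (fun w hw => (hder w (hseg w hw)).hasDerivWithinAt) (fun w _ => by simp)
    (left_mem_segment ℝ x y) (right_mem_segment ℝ x y)
  rw [zero_mul, norm_le_zero_iff, sub_eq_zero] at this
  exact this.symm

theorem eventually_mem_iff_of_notMem_frontier {V : Set ℂ} {w : ℂ} (hw : w ∉ frontier V) :
    ∀ᶠ z in 𝓝 w, z ∈ V ↔ w ∈ V := by
  by_cases h : w ∈ V
  · have : w ∈ interior V := by
      by_contra hi
      exact hw ⟨subset_closure h, hi⟩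
    filter_upwards [mem_interior_iff_mem_nhds.1 this] with z hz
    simp [hz, h]
  · have : w ∉ closure V := fun hc => hw ⟨hc, fun hi => h (interior_subset hi)⟩
    filter_upwards [isClosed_closure.isOpen_compl.mem_nhds this] with z hz
    have : z ∉ V := fun hz' => hz (subset_closure hz')
    simp [this, h]

namespace IsOrientedC1Boundary

variable {V : Set ℂ} {n : ℕ} {γ : Fin n → ℝ → ℂ}

/-- A function that is locally constant off the boundary, and does not jump across it, is constant
near each boundary point: in the coordinate `ζ = (z - p) / γ' t₀` the boundary is near `0` a curve
with `|Im ζ| ≤ |Re ζ|` that meets each vertical line once, so that each point off it can be joined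
to a point of the imaginary axis by a vertical and a horizontal segment. -/
theorem exists_eventually_eq_const (hb : IsOrientedC1Boundary V γ) (j : Fin n) (t₀ : ℝ) {h : ℂ → ℂ}
    (hder : ∀ w ∉ frontier V, HasDerivAt h 0 w)
    (hjump : Tendsto (fun ε : ℝ => h (γ j t₀ + ε * (Complex.I * deriv (γ j) t₀)) -
      h (γ j t₀ - ε * (Complex.I * deriv (γ j) t₀))) (𝓝[>] 0) (𝓝 0)) :
    ∃ c, ∀ᶠ w in 𝓝 (γ j t₀), w ∉ frontier V → h w = c := by
  set p := γ j t₀ with hp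
  set d := deriv (γ j) t₀ with hdd
  have hd : d ≠ 0 := hb.deriv_ne_zero j t₀
  obtain ⟨η, hη, -, hq⟩ := exists_norm_div_deriv_sub_le (hb.contDiff j) (t₀ := t₀) hd
  rw [← hdd] at hq
  set q : ℝ → ℂ := fun t => (γ j t - p) / d with hqdef
  set ψ : ℂ → ℂ := fun ζ => p + d * ζ with hψ
  have hqsub : ∀ s t, (γ j t - γ j s) / d = q t - q s := fun s t => by
    simp only [hqdef]; ring
  have hq0 : q t₀ = 0 := by simp [hqdef, hp]
  have ht₀ : t₀ ∈ Icc (t₀ - η) (t₀ + η) := ⟨by linarith, by linarith⟩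
  have hre : ∀ s ∈ Icc (t₀ - η) (t₀ + η), ∀ t ∈ Icc (t₀ - η) (t₀ + η),
      |(q t).re - (q s).re - (t - s)| ≤ 1 / 2 * |t - s| := fun s hs t ht => by
    have := (Complex.abs_re_le_norm _).trans (hq s hs t ht)
    rw [hqsub] at this
    simpa using this
  have him : ∀ t ∈ Icc (t₀ - η) (t₀ + η), |(q t).im| ≤ |(q t).re| := fun t ht => by
    have h1 := (Complex.abs_im_le_norm _).trans (hq t₀ ht₀ t ht)
    have h2 := hre t₀ ht₀ t ht
    rw [hqsub, hq0] at h1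
    rw [hq0] at h2
    simp only [sub_zero, Complex.sub_im, Complex.ofReal_im, Complex.zero_re] at h1 h2
    have h3 := abs_sub_abs_le_abs_sub (t - t₀) (q t).re
    rw [abs_sub_comm (t - t₀)] at h3
    linarith
  have hinj : ∀ s ∈ Icc (t₀ - η) (t₀ + η), ∀ t ∈ Icc (t₀ - η) (t₀ + η),
      (q t).re = (q s).re → t = s := fun s hs t ht hst => by
    have h1 := hre s hs t ht
    rw [hst, sub_self, zero_sub, abs_neg] at h1
    have : |t - s| = 0 := le_antisymm (by linarith) (abs_nonneg _)
    exact sub_eq_zero.1 (abs_eq_zero.1 this)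
  obtain ⟨δ, hδ, hδΓ⟩ : ∃ δ > 0, ∀ ζ : ℂ, ‖ζ‖ < δ → ψ ζ ∈ frontier V →
      ∃ t ∈ Icc (t₀ - η) (t₀ + η), ζ = q t := by
    have hψc : Tendsto ψ (𝓝 0) (𝓝 p) := by
      have : Continuous ψ := by fun_prop
      simpa [hψ] using this.tendsto 0
    obtain ⟨δ, hδ, hball⟩ := Metric.eventually_nhds_iff_ball.1
      (hψc.eventually (hb.eventually_exists_eq j t₀ hη))
    refine ⟨δ, hδ, fun ζ hζ hΓ => ?_⟩
    obtain ⟨t, ht, h1⟩ := hball ζ (by simpa using hζ) hΓ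
    refine ⟨t, ht, ?_⟩
    simp only [hqdef, ← h1, hψ]
    field_simp
    ring
  set s := min (δ / 4) (η / 2) with hs
  have hs0 : 0 < s := by positivity
  have hsδ : s ≤ δ / 4 := min_le_left _ _
  have hsη : s ≤ η / 2 := min_le_right _ _
  have hbox : ∀ ζ : ℂ, |ζ.re| ≤ s → |ζ.im| ≤ 2 * s → ψ ζ ∈ frontier V →
      ∃ t ∈ Icc (t₀ - η) (t₀ + η), ζ = q t := fun ζ h1 h2 => hδΓ ζ (by
    have := Complex.norm_le_abs_re_add_abs_im ζ
    linarith)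
  have hcross : ∀ a : ℝ, |a| ≤ s → ∃ t ∈ Icc (t₀ - η) (t₀ + η), (q t).re = a := fun a ha => by
    have h1 := hre t₀ ht₀ (t₀ - η) ⟨le_rfl, by linarith⟩
    have h2 := hre t₀ ht₀ (t₀ + η) ⟨by linarith, le_rfl⟩
    rw [hq0, abs_le] at h1 h2
    simp only [sub_sub_cancel_left, add_sub_cancel_left, abs_neg, abs_of_pos hη, Complex.zero_re,
      sub_zero] at h1 h2
    have hqc : Continuous fun t => (q t).re :=
      Complex.continuous_re.comp (((hb.contDiff j).continuous.sub continuous_const).div_const d)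
    have ha' := abs_le.1 ha
    exact intermediate_value_Icc (by linarith : t₀ - η ≤ t₀ + η) hqc.continuousOn
      ⟨by linarith, by linarith⟩
  have hseg : ∀ ζ₁ ζ₂ : ℂ, (∀ θ ∈ Icc (0 : ℝ) 1, ψ (ζ₁ + θ * (ζ₂ - ζ₁)) ∉ frontier V) →
      h (ψ ζ₁) = h (ψ ζ₂) := fun ζ₁ ζ₂ h12 =>
    eq_of_hasDerivAt_zero_of_segment hder fun θ hθ => by
      convert! h12 θ hθ using 2
      simp only [hψ, Complex.real_smul]
      ring
  have haxis : ∀ τ : ℝ, τ ≠ 0 → |τ| ≤ 2 * s → ψ (τ * Complex.I) ∉ frontier V :=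
    fun τ hτ hτs hΓ => by
      obtain ⟨t, ht, h1⟩ := hbox (τ * Complex.I) (by simpa using hs0.le) (by simpa using hτs) hΓ
      have h2 := him t ht
      rw [← h1] at h2
      exact hτ (by simpa using h2)
  -- the values on the two half-axes agree, because there is no jump
  have hup : ∀ ε ∈ Ioc 0 (2 * s), h (ψ ((ε : ℝ) * Complex.I)) = h (ψ ((2 * s : ℝ) * Complex.I)) :=
    fun ε hε => hseg _ _ fun θ hθ => by
      have h1 : 0 ≤ θ * (2 * s - ε) := mul_nonneg hθ.1 (by linarith [hε.2])
      have h2 : θ * (2 * s - ε) ≤ 2 * s - ε := mul_le_of_le_one_left (by linarith [hε.2]) hθ.2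
      have h3 := haxis (ε + θ * (2 * s - ε)) (by linarith [hε.1])
        (abs_le.2 ⟨by linarith [hε.1], by linarith⟩)
      convert! h3 using 2
      push_cast
      ring
  have hdown : ∀ ε ∈ Ioc 0 (2 * s),
      h (ψ ((-ε : ℝ) * Complex.I)) = h (ψ ((-(2 * s) : ℝ) * Complex.I)) :=
    fun ε hε => hseg _ _ fun θ hθ => by
      have h1 : 0 ≤ θ * (2 * s - ε) := mul_nonneg hθ.1 (by linarith [hε.2])
      have h2 : θ * (2 * s - ε) ≤ 2 * s - ε := mul_le_of_le_one_left (by linarith [hε.2]) hθ.2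
      have h3 := haxis (-(ε + θ * (2 * s - ε))) (by linarith [hε.1])
        (abs_le.2 ⟨by linarith [hε.1], by linarith [hε.1]⟩)
      convert! h3 using 2
      push_cast
      ring
  have hagree : h (ψ ((2 * s : ℝ) * Complex.I)) = h (ψ ((-(2 * s) : ℝ) * Complex.I)) := by
    rw [← sub_eq_zero]
    refine tendsto_nhds_unique (tendsto_const_nhds.congr' ?_) hjump
    filter_upwards [Ioc_mem_nhdsGT (by positivity : 0 < 2 * s)] with ε hε
    rw [← hup ε hε, ← hdown ε hε]
    congr 2
    · simp only [hψ]; ring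
    · simp only [hψ]; push_cast; ring
  refine ⟨h (ψ ((2 * s : ℝ) * Complex.I)), ?_⟩
  have hφ : Tendsto (fun w => ‖(w - p) / d‖) (𝓝 p) (𝓝 0) := by
    have : Continuous fun w => ‖(w - p) / d‖ := by fun_prop
    simpa using this.tendsto p
  filter_upwards [hφ.eventually (gt_mem_nhds hs0)] with w hw hwΓ
  set ζ := (w - p) / d with hζ
  have hwζ : w = ψ ζ := by
    simp only [hψ, hζ]
    field_simp
    ring
  have ha : |ζ.re| ≤ s := (Complex.abs_re_le_norm ζ).trans hw.le
  have hbs : |ζ.im| ≤ s := (Complex.abs_im_le_norm ζ).trans hw.le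
  obtain ⟨t, ht, hta⟩ := hcross ζ.re ha
  have hoff : ∀ b : ℝ, |b| ≤ 2 * s → b ≠ (q t).im →
      ψ (ζ.re + b * Complex.I) ∉ frontier V := fun b hbb hne hΓ => by
    obtain ⟨t', ht', h1⟩ := hbox _ (by simpa using ha) (by simpa using hbb) hΓ
    have h2 : t' = t := hinj t ht t' ht' (by rw [← h1, hta]; simp)
    rw [h2] at h1
    exact hne (by rw [← h1]; simp)
  have hhor : ∀ a b : ℝ, |a| ≤ s → |b| = 2 * s →
      ψ (a + b * Complex.I) ∉ frontier V := fun a b haa hbb hΓ => by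
    obtain ⟨t', ht', h1⟩ := hbox _ (by simpa using haa) (by simpa using hbb.le) hΓ
    have h2 := him t' ht'
    rw [← h1] at h2
    simp only [Complex.add_im, Complex.ofReal_im, Complex.mul_im, Complex.ofReal_re, Complex.I_im,
      mul_one, Complex.I_re, mul_zero, add_zero, zero_add, Complex.add_re, Complex.mul_re,
      sub_zero] at h2
    linarith
  have hhor' : ∀ b : ℝ, |b| = 2 * s →
      h (ψ (ζ.re + b * Complex.I)) = h (ψ (b * Complex.I)) := fun b hbb =>
    hseg _ _ fun θ hθ => by
      have h3 := hhor ((1 - θ) * ζ.re) b (by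
        rw [abs_mul, abs_of_nonneg (by linarith [hθ.2])]
        exact (mul_le_of_le_one_left (abs_nonneg _) (by linarith [hθ.1])).trans ha) hbb
      convert! h3 using 2
      push_cast
      ring
  have hζeq : ζ = ζ.re + ζ.im * Complex.I := (Complex.re_add_im ζ).symm
  have hne : ζ.im ≠ (q t).im := fun heq => hwΓ (by
    have : ζ = q t := Complex.ext hta.symm heq
    rw [hwζ, this]
    have h2 : ψ (q t) = γ j t := by
      simp only [hψ, hqdef]
      field_simp
      ring
    rw [h2]
    exact hb.mem_frontier j t)
  have hbs' := abs_le.1 hbs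
  rcases lt_or_gt_of_ne hne with hlt | hgt
  · have hv : h (ψ ζ) = h (ψ (ζ.re + (-(2 * s) : ℝ) * Complex.I)) := by
      conv_lhs => rw [hζeq]
      refine hseg _ _ fun θ hθ => ?_
      have h1 : 0 ≤ θ * (2 * s + ζ.im) := mul_nonneg hθ.1 (by linarith)
      have h2 : θ * (2 * s + ζ.im) ≤ 2 * s + ζ.im := mul_le_of_le_one_left (by linarith) hθ.2
      have h3 := hoff (ζ.im - θ * (2 * s + ζ.im)) (abs_le.2 ⟨by linarith, by linarith⟩)
        (by linarith)
      convert! h3 using 2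
      push_cast
      ring
    rw [hwζ, hv, hhor' _ (by rw [abs_neg, abs_of_pos (by positivity)]), hagree]
  · have hv : h (ψ ζ) = h (ψ (ζ.re + (2 * s : ℝ) * Complex.I)) := by
      conv_lhs => rw [hζeq]
      refine hseg _ _ fun θ hθ => ?_
      have h1 : 0 ≤ θ * (2 * s - ζ.im) := mul_nonneg hθ.1 (by linarith)
      have h2 : θ * (2 * s - ζ.im) ≤ 2 * s - ζ.im := mul_le_of_le_one_left (by linarith) hθ.2
      have h3 := hoff (ζ.im + θ * (2 * s - ζ.im)) (abs_le.2 ⟨by linarith, by linarith⟩)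
        (by linarith)
      convert! h3 using 2
      push_cast
      ring
    rw [hwζ, hv, hhor' _ (abs_of_pos (by positivity))]

/-- The index of the oriented boundary of a compact set `V` is `1` in `V` and `0` outside: the
difference with the indicator function of `V` is locally constant off the boundary, does not jump
across it, and vanishes at infinity. -/
theorem contourCauchyIntegral_one_eq (hb : IsOrientedC1Boundary V γ) (hV : IsCompact V) {w : ℂ}
    (hw : w ∉ frontier V) :
    contourCauchyIntegral γ (fun _ => (1 : ℂ)) w = V.indicator 1 w := by
  set h : ℂ → ℂ := fun w => contourCauchyIntegral γ (fun _ => (1 : ℂ)) w - V.indicator 1 w with hh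
  have hder : ∀ w ∉ frontier V, HasDerivAt h 0 w := by
    intro w hw
    have h1 := hasDerivAt_contourCauchyIntegral_one hb.contDiff hb.periodic
      (by rwa [hb.iUnion_range] : w ∉ _)
    have h2 : HasDerivAt (V.indicator (1 : ℂ → ℂ)) 0 w := by
      refine (hasDerivAt_const w (V.indicator (1 : ℂ → ℂ) w)).congr_of_eventuallyEq ?_
      filter_upwards [eventually_mem_iff_of_notMem_frontier hw] with z hz
      by_cases hzV : z ∈ V
      · rw [indicator_of_mem hzV, indicator_of_mem (hz.1 hzV)]; rfl
      · rw [indicator_of_notMem hzV, indicator_of_notMem (fun h => hzV (hz.2 h))]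
    have h3 := h1.sub h2
    rw [sub_zero] at h3
    exact h3
  have hloc : ∀ z, ∃ c, ∀ᶠ w in 𝓝 z, w ∉ frontier V → h w = c := by
    intro z
    by_cases hz : z ∈ frontier V
    · rw [← hb.iUnion_range] at hz
      obtain ⟨j, t₀, rfl⟩ := mem_iUnion.1 hz
      refine hb.exists_eventually_eq_const j t₀ hder ?_
      have h1 := (hb.tendsto_jump hV.isClosed j t₀).sub_const 1
      rw [sub_self] at h1
      refine h1.congr' ?_
      filter_upwards [hb.left_mem j t₀, hb.right_notMem j t₀] with ε h2 h3
      simp only [hh]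
      rw [indicator_of_mem (interior_subset h2), indicator_of_notMem h3, Pi.one_apply]
      ring
    · obtain ⟨r, hr, hball⟩ := Metric.isOpen_iff.1 isClosed_frontier.isOpen_compl z hz
      refine ⟨h z, ?_⟩
      filter_upwards [Metric.ball_mem_nhds z hr] with w hw _
      refine (eq_of_hasDerivAt_zero_of_segment hder fun θ hθ => hball ?_).symm
      exact (convex_ball z r).add_smul_sub_mem (Metric.mem_ball_self hr) hw hθ
  choose c hc using hloc
  have hdense : ∀ z, ∃ᶠ w in 𝓝 z, w ∉ frontier V := by
    intro z hz
    have h1 : z ∈ interior (frontier V) := mem_interior_iff_mem_nhds.2 (by simpa using hz)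
    rw [interior_frontier hV.isClosed] at h1
    exact h1
  have hcl : IsLocallyConstant c := by
    rw [IsLocallyConstant.iff_eventually_eq]
    intro z
    filter_upwards [(hc z).eventually_nhds] with z' hz'
    obtain ⟨w, hw1, hw2, hw3⟩ := ((hdense z').and_eventually (hz'.and (hc z'))).exists
    rw [← hw3 hw1, hw2 hw1]
  have hhc : ∀ w ∉ frontier V, h w = c w := fun w hw => (hc w).self_of_nhds hw
  have hlim : Tendsto h (cocompact ℂ) (𝓝 0) := by
    have h1 := tendsto_contourCauchyIntegral_cocompact hb.contDiff
      (continuousOn_const (c := (1 : ℂ)) (s := ⋃ j, range (γ j)))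
    refine h1.congr' ?_
    filter_upwards [hV.compl_mem_cocompact] with w hw
    simp only [hh]
    rw [indicator_of_notMem hw, sub_zero]
  have hc0 : c w = 0 := by
    refine tendsto_nhds_unique (f := h) (l := cocompact ℂ) (tendsto_const_nhds.congr' ?_) hlim
    filter_upwards [hV.compl_mem_cocompact] with z hz
    rw [hhc z fun hf => hz (hV.isClosed.frontier_subset hf)]
    exact hcl.apply_eq_of_isPreconnected isPreconnected_univ (mem_univ _) (mem_univ _)
  have := hhc w hw
  rw [hc0] at this
  exact sub_eq_zero.1 this

end IsOrientedC1Boundary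

/-! ### The Riesz projection -/

namespace IsRieszContour

variable {H : Type*} [NormedAddCommGroup H] [NormedSpace ℂ H]
  {A : H →ₗ.[ℂ] H} {τ V : Set ℂ} {n : ℕ} {γ : Fin n → ℝ → ℂ}

theorem frontier_subset {σ : Set ℂ} (hV : IsRieszContour σ τ V γ) : frontier V ⊆ σᶜ := by
  intro z hz hσ
  by_cases h : z ∈ τ
  · exact disjoint_interior_frontier.notMem_of_mem_left
      (subset_interior_iff_mem_nhdsSet.2 hV.mem_nhdsSet h) hz
  · exact hV.disjoint.notMem_of_mem_left (hV.isCompact.isClosed.frontier_subset hz) ⟨hσ, h⟩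

theorem subset_union {σ : Set ℂ} (hV : IsRieszContour σ τ V γ) : σ ⊆ interior V ∪ Vᶜ := by
  intro z hσ
  by_cases h : z ∈ τ
  · exact Or.inl (subset_interior_iff_mem_nhdsSet.2 hV.mem_nhdsSet h)
  · exact Or.inr fun hz => hV.disjoint.notMem_of_mem_left hz ⟨hσ, h⟩

theorem mem_resolventSet (hV : IsRieszContour (UnboundedOperator.spectrum A) τ V γ) (j : Fin n)
    (t : ℝ) : γ j t ∈ UnboundedOperator.resolventSet A :=
  not_not.1 (hV.frontier_subset (hV.boundary.mem_frontier j t))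

variable [CompleteSpace H]

theorem continuousOn_resolvent (hV : IsRieszContour (UnboundedOperator.spectrum A) τ V γ) :
    ContinuousOn (UnboundedOperator.resolvent A) (⋃ j, range (γ j)) := by
  intro z hz
  obtain ⟨j, t, rfl⟩ := mem_iUnion.1 hz
  exact (UnboundedOperator.continuousAt_resolvent (hV.mem_resolventSet j t)).continuousWithinAt

theorem continuous_deriv_smul_resolvent
    (hV : IsRieszContour (UnboundedOperator.spectrum A) τ V γ) (j : Fin n) :
    Continuous fun t => deriv (γ j) t • UnboundedOperator.resolvent A (γ j t) :=
  continuous_deriv_smul_comp hV.boundary.contDiff hV.continuousOn_resolvent j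

/-- An operator that commutes with the resolvent commutes with the Riesz integral. -/
theorem comp_rieszIntegral_comm (hV : IsRieszContour (UnboundedOperator.spectrum A) τ V γ)
    {B : H →L[ℂ] H} (hB : ∀ z ∈ UnboundedOperator.resolventSet A,
      B ∘L UnboundedOperator.resolvent A z = UnboundedOperator.resolvent A z ∘L B) :
    B ∘L UnboundedOperator.rieszIntegral A γ = UnboundedOperator.rieszIntegral A γ ∘L B := by
  have hint := fun j => (hV.continuous_deriv_smul_resolvent j).intervalIntegrable
    (μ := MeasureTheory.volume) 0 1
  ext v
  have h1 : ∀ x, UnboundedOperator.rieszIntegral A γ x = (2 * (Real.pi : ℂ) * Complex.I)⁻¹ •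
      ∑ j, ∫ t in (0 : ℝ)..1, deriv (γ j) t • UnboundedOperator.resolvent A (γ j t) x := by
    intro x
    simp only [UnboundedOperator.rieszIntegral, smul_apply, sum_apply]
    congr 2 with j
    rw [ContinuousLinearMap.intervalIntegral_apply (hint j)]
    rfl
  simp only [ContinuousLinearMap.comp_apply, h1, map_smul, map_sum]
  congr 2 with j
  have hint' : IntervalIntegrable
      (fun t => deriv (γ j) t • UnboundedOperator.resolvent A (γ j t) v)
      MeasureTheory.volume 0 1 :=
    Continuous.intervalIntegrable
      ((hV.continuous_deriv_smul_resolvent j).clm_apply continuous_const) 0 1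
  rw [← ContinuousLinearMap.intervalIntegral_comp_comm _ hint']
  refine intervalIntegral.integral_congr fun t _ => ?_
  simp only [map_smul]
  congr 1
  exact congrArg (fun C : H →L[ℂ] H => C v) (hB _ (hV.mem_resolventSet j t))

theorem differentiableAt_cauchyIntegral_resolvent
    (hV : IsRieszContour (UnboundedOperator.spectrum A) τ V γ) {w : ℂ} (hw : w ∉ frontier V) :
    DifferentiableAt ℂ (contourCauchyIntegral γ (UnboundedOperator.resolvent A)) w :=
  (hasDerivAt_contourCauchyIntegral hV.boundary.contDiff hV.continuousOn_resolvent
    (by rwa [hV.boundary.iUnion_range])).differentiableAt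

/-- The Cauchy integral of the resolvent is a left inverse of `w - A` modulo the Riesz
integral. -/
theorem cauchyIntegral_resolvent_apply
    (hV : IsRieszContour (UnboundedOperator.spectrum A) τ V γ) {w : ℂ} (hw : w ∉ frontier V)
    (u : A.domain) :
    contourCauchyIntegral γ (UnboundedOperator.resolvent A) w (w • (u : H) - A u) =
      V.indicator (1 : ℂ → ℂ) w • (u : H) - UnboundedOperator.rieszIntegral A γ u := by
  have hne : ∀ j t, γ j t - w ≠ 0 := fun j t h => hw (by
    rw [← sub_eq_zero.1 h]; exact hV.boundary.mem_frontier j t)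
  have hinv : ∀ j, Continuous fun t => (γ j t - w)⁻¹ := fun j =>
    ((hV.boundary.contDiff j).continuous.sub continuous_const).inv₀ (hne j)
  have hder : ∀ j, Continuous (deriv (γ j)) := fun j =>
    (hV.boundary.contDiff j).continuous_deriv le_rfl
  rw [← hV.boundary.contourCauchyIntegral_one_eq hV.isCompact hw]
  simp only [contourCauchyIntegral, UnboundedOperator.rieszIntegral, smul_apply, sum_apply,
    smul_assoc, ← smul_sub, Finset.sum_smul, ← Finset.sum_sub_distrib]
  congr 2 with j
  have hc : Continuous fun t =>
      (γ j t - w)⁻¹ • deriv (γ j) t • UnboundedOperator.resolvent A (γ j t) :=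
    (hinv j).smul (hV.continuous_deriv_smul_resolvent j)
  rw [ContinuousLinearMap.intervalIntegral_apply (hc.intervalIntegrable _ _),
    ContinuousLinearMap.intervalIntegral_apply
      ((hV.continuous_deriv_smul_resolvent j).intervalIntegrable _ _),
    ← intervalIntegral.integral_smul_const, ← intervalIntegral.integral_sub]
  · refine intervalIntegral.integral_congr fun t _ => ?_
    simp only [smul_apply]
    rw [UnboundedOperator.resolvent_apply_sub (hV.mem_resolventSet j t), smul_add, smul_add,
      smul_smul, smul_smul _ (w - γ j t)]
    have h1 : (γ j t - w)⁻¹ * (deriv (γ j) t * (w - γ j t)) = -deriv (γ j) t := by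
      have := hne j t
      field_simp
      ring
    rw [smul_smul, mul_assoc, h1, neg_smul, smul_eq_mul, smul_eq_mul, mul_one]
    abel
  · exact Continuous.intervalIntegrable
      (((hinv j).smul ((hder j).smul continuous_const)).smul continuous_const) _ _
  · exact Continuous.intervalIntegrable
      ((hV.continuous_deriv_smul_resolvent j).clm_apply continuous_const) _ _

theorem cauchyIntegral_resolvent_eq
    (hV : IsRieszContour (UnboundedOperator.spectrum A) τ V γ) {w : ℂ} (hw : w ∉ frontier V)
    (hwρ : w ∈ UnboundedOperator.resolventSet A) :
    contourCauchyIntegral γ (UnboundedOperator.resolvent A) w = UnboundedOperator.resolvent A w ∘L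
      (V.indicator (1 : ℂ → ℂ) w • ContinuousLinearMap.id ℂ H -
        UnboundedOperator.rieszIntegral A γ) := by
  ext v
  obtain ⟨h1, h2⟩ := (UnboundedOperator.isResolventAt_resolvent hwρ).1 v
  have h3 := hV.cauchyIntegral_resolvent_apply hw ⟨_, h1⟩
  have h4 := congrArg (fun C : H →L[ℂ] H => C v) (hV.comp_rieszIntegral_comm
    (B := UnboundedOperator.resolvent A w) fun z hz =>
      UnboundedOperator.resolvent_commute hz hwρ)
  simp only [ContinuousLinearMap.comp_apply] at h4
  rw [h2] at h3
  simp [h3, h4]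

theorem cauchyIntegral_resolvent_eq_of_mem
    (hV : IsRieszContour (UnboundedOperator.spectrum A) τ V γ) {w : ℂ} (hw : w ∈ interior V)
    (hwρ : w ∈ UnboundedOperator.resolventSet A) :
    contourCauchyIntegral γ (UnboundedOperator.resolvent A) w = UnboundedOperator.resolvent A w ∘L
      (ContinuousLinearMap.id ℂ H - UnboundedOperator.rieszIntegral A γ) := by
  rw [hV.cauchyIntegral_resolvent_eq (disjoint_interior_frontier.notMem_of_mem_left hw) hwρ,
    indicator_of_mem (interior_subset hw), Pi.one_apply, one_smul]

theorem notMem_frontier_of_notMem {σ : Set ℂ} (hV : IsRieszContour σ τ V γ) {w : ℂ}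
    (hw : w ∉ V) : w ∉ frontier V :=
  fun h => hw (hV.isCompact.isClosed.frontier_subset h)

theorem cauchyIntegral_resolvent_eq_of_notMem
    (hV : IsRieszContour (UnboundedOperator.spectrum A) τ V γ) {w : ℂ} (hw : w ∉ V)
    (hwρ : w ∈ UnboundedOperator.resolventSet A) :
    contourCauchyIntegral γ (UnboundedOperator.resolvent A) w =
      -(UnboundedOperator.resolvent A w ∘L UnboundedOperator.rieszIntegral A γ) := by
  rw [hV.cauchyIntegral_resolvent_eq (hV.notMem_frontier_of_notMem hw) hwρ,
    indicator_of_notMem hw, zero_smul, zero_sub, ContinuousLinearMap.comp_neg]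

/-- The Riesz integral `P` is a projection: `(z - A)⁻¹ P (1 - P)` extends holomorphically to the
interior of `V` because `(z - A)⁻¹ (1 - P)` does, and to the complement of `V` because
`(z - A)⁻¹ P` does. -/
theorem rieszIntegral_comp_self (hV : IsRieszContour (UnboundedOperator.spectrum A) τ V γ)
    (hρ : (UnboundedOperator.resolventSet A).Nonempty) :
    UnboundedOperator.rieszIntegral A γ ∘L UnboundedOperator.rieszIntegral A γ =
      UnboundedOperator.rieszIntegral A γ := by
  set P := UnboundedOperator.rieszIntegral A γ with hP
  set T := contourCauchyIntegral γ (UnboundedOperator.resolvent A) with hT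
  have hX : P - P ∘L P = 0 := by
    refine UnboundedOperator.eq_zero_of_resolvent_comp_extends hρ (U := interior V) (U' := Vᶜ)
      (T := fun w => T w ∘L P) (T' := fun w => -(T w ∘L (ContinuousLinearMap.id ℂ H - P)))
      isOpen_interior hV.isCompact.isClosed.isOpen_compl
      (disjoint_compl_right.mono_left interior_subset) hV.subset_union
      (by simpa using hV.isCompact.isBounded) ?_ ?_ ?_ ?_ ?_
    · intro w hw
      exact ((hV.differentiableAt_cauchyIntegral_resolvent
        (disjoint_interior_frontier.notMem_of_mem_left hw)).clm_comp
          (differentiableAt_const _)).differentiableWithinAt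
    · intro w hw
      exact ((hV.differentiableAt_cauchyIntegral_resolvent
        (hV.notMem_frontier_of_notMem hw)).clm_comp
          (differentiableAt_const _)).neg.differentiableWithinAt
    · intro w hw hwρ
      ext v
      simp [hT, hV.cauchyIntegral_resolvent_eq_of_mem hw hwρ, hP]
    · intro w hw hwρ
      ext v
      simp only [hT, hV.cauchyIntegral_resolvent_eq_of_notMem hw hwρ, neg_apply,
        ContinuousLinearMap.comp_apply, sub_apply, map_sub, ContinuousLinearMap.id_apply]
      abel
    · have h1 := tendsto_contourCauchyIntegral_cocompact hV.boundary.contDiff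
        hV.continuousOn_resolvent
      have h2 : Continuous fun B : H →L[ℂ] H => -(B ∘L (ContinuousLinearMap.id ℂ H - P)) := by
        fun_prop
      simpa [Function.comp_def] using (h2.tendsto 0).comp h1
  exact (sub_eq_zero.1 hX).symm

/-- Two contours around the same part of the spectrum give the same Riesz integral. -/
theorem rieszIntegral_eq (hV : IsRieszContour (UnboundedOperator.spectrum A) τ V γ)
    {V' : Set ℂ} {n' : ℕ} {γ' : Fin n' → ℝ → ℂ}
    (hV' : IsRieszContour (UnboundedOperator.spectrum A) τ V' γ')
    (hρ : (UnboundedOperator.resolventSet A).Nonempty) :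
    UnboundedOperator.rieszIntegral A γ' = UnboundedOperator.rieszIntegral A γ := by
  set T := contourCauchyIntegral γ (UnboundedOperator.resolvent A) with hT
  set T' := contourCauchyIntegral γ' (UnboundedOperator.resolvent A) with hT'
  refine sub_eq_zero.1 ?_
  have hopen : IsOpen (Vᶜ ∩ V'ᶜ) :=
    hV.isCompact.isClosed.isOpen_compl.inter hV'.isCompact.isClosed.isOpen_compl
  refine UnboundedOperator.eq_zero_of_resolvent_comp_extends hρ
    (U := interior V ∩ interior V') (U' := Vᶜ ∩ V'ᶜ) (T := fun w => T w - T' w)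
    (T' := fun w => T w - T' w)
    (isOpen_interior.inter isOpen_interior) hopen ?_ ?_ ?_ ?_ ?_ ?_ ?_ ?_
  · exact (disjoint_compl_right.mono_left interior_subset).mono inter_subset_left inter_subset_left
  · intro z hz
    by_cases h : z ∈ τ
    · exact Or.inl ⟨subset_interior_iff_mem_nhdsSet.2 hV.mem_nhdsSet h,
        subset_interior_iff_mem_nhdsSet.2 hV'.mem_nhdsSet h⟩
    · exact Or.inr ⟨fun h' => hV.disjoint.notMem_of_mem_left h' ⟨hz, h⟩,
        fun h' => hV'.disjoint.notMem_of_mem_left h' ⟨hz, h⟩⟩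
  · rw [compl_inter, compl_compl, compl_compl]
    exact hV.isCompact.isBounded.union hV'.isCompact.isBounded
  · intro w hw
    exact ((hV.differentiableAt_cauchyIntegral_resolvent
      (disjoint_interior_frontier.notMem_of_mem_left hw.1)).sub
      (hV'.differentiableAt_cauchyIntegral_resolvent
      (disjoint_interior_frontier.notMem_of_mem_left hw.2))).differentiableWithinAt
  · intro w hw
    exact ((hV.differentiableAt_cauchyIntegral_resolvent (hV.notMem_frontier_of_notMem hw.1)).sub
      (hV'.differentiableAt_cauchyIntegral_resolvent
        (hV'.notMem_frontier_of_notMem hw.2))).differentiableWithinAt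
  · intro w hw hwρ
    ext v
    simp [hT, hT', hV.cauchyIntegral_resolvent_eq_of_mem hw.1 hwρ,
      hV'.cauchyIntegral_resolvent_eq_of_mem hw.2 hwρ]
  · intro w hw hwρ
    ext v
    simp only [hT, hT', hV.cauchyIntegral_resolvent_eq_of_notMem hw.1 hwρ,
      hV'.cauchyIntegral_resolvent_eq_of_notMem hw.2 hwρ, sub_apply, neg_apply,
      ContinuousLinearMap.comp_apply, map_sub]
    abel
  · have h1 := tendsto_contourCauchyIntegral_cocompact hV.boundary.contDiff
      hV.continuousOn_resolvent
    have h2 := tendsto_contourCauchyIntegral_cocompact hV'.boundary.contDiff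
      hV'.continuousOn_resolvent
    simpa using h1.sub h2

/-- If the resolvent is bounded on `Ω` away from `τ`, then the operators `w - A`, `w ∈ Ω`, have
uniformly bounded left inverses modulo the Riesz integral: near `τ` these are given by the Cauchy
integral of the resolvent. -/
theorem exists_bounded_leftInverse (hV : IsRieszContour (UnboundedOperator.spectrum A) τ V γ)
    (hτ : IsCompact τ) {Ω : Set ℂ}
    (hΩ : ∀ U ∈ 𝓝ˢ τ, UnboundedOperator.ResolventBoundedOn A (Ω \ U)) :
    ∃ C : ℝ, ∀ w ∈ Ω, ∃ E : H →L[ℂ] H, ‖E‖ ≤ C ∧ ∀ u : A.domain,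
      E (w • (u : H) - A u) = u - UnboundedOperator.rieszIntegral A γ u := by
  set P := UnboundedOperator.rieszIntegral A γ with hP
  obtain ⟨K, hK, hτK, hKV⟩ := exists_compact_between hτ isOpen_interior
    (subset_interior_iff_mem_nhdsSet.2 hV.mem_nhdsSet)
  have hKf : ∀ w ∈ K, w ∉ frontier V := fun w hw =>
    disjoint_interior_frontier.notMem_of_mem_left (hKV hw)
  obtain ⟨C₁, hC₁⟩ := hK.exists_bound_of_continuousOn
    (f := contourCauchyIntegral γ (UnboundedOperator.resolvent A)) fun w hw =>
      (hV.differentiableAt_cauchyIntegral_resolvent (hKf w hw)).continuousAt.continuousWithinAt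
  obtain ⟨hsub, C₂, hC₂⟩ := hΩ (interior K) (isOpen_interior.mem_nhdsSet.2 hτK)
  refine ⟨max C₁ (C₂ * ‖ContinuousLinearMap.id ℂ H - P‖), fun w hw => ?_⟩
  by_cases hwK : w ∈ interior K
  · refine ⟨contourCauchyIntegral γ (UnboundedOperator.resolvent A) w,
      (hC₁ w (interior_subset hwK)).trans (le_max_left _ _),
      fun u => ?_⟩
    rw [hV.cauchyIntegral_resolvent_apply (hKf w (interior_subset hwK)),
      indicator_of_mem (interior_subset (hKV (interior_subset hwK))), Pi.one_apply, one_smul]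
  · have hwρ := hsub ⟨hw, hwK⟩
    have hcomm := hV.comp_rieszIntegral_comm (B := UnboundedOperator.resolvent A w) fun z hz =>
      UnboundedOperator.resolvent_commute hz hwρ
    refine ⟨(ContinuousLinearMap.id ℂ H - P) ∘L UnboundedOperator.resolvent A w, ?_, fun u => ?_⟩
    · refine ((ContinuousLinearMap.opNorm_comp_le _ _).trans ?_).trans
        (le_max_right _ _)
      rw [mul_comm]
      have := hC₂ w ⟨hw, hwK⟩
      gcongr
    · rw [ContinuousLinearMap.comp_apply, (UnboundedOperator.isResolventAt_resolvent hwρ).2 u]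
      simp

end IsRieszContour

/-! ### The weighted estimate -/

namespace C0Semigroup

open MeasureTheory FourierTransform

section LeftInverse

variable {H : Type*} [NormedAddCommGroup H] [NormedSpace ℂ H] [CompleteSpace H]
  (S : C0Semigroup H) {P E : H →L[ℂ] H} {z : ℂ} {u : H}

/-- A left inverse of `z - A` modulo `P` sends `u - e^{-z t} S t u`, which is `z - A` applied to the
truncated Laplace transform of the orbit of `u`, back to that transform. -/
theorem leftInverse_apply_sub_eq_truncatedLaplace
    (hE : ∀ v : S.generator.domain, E (z • (v : H) - S.generator v) = v - P v)
    (hPu : ∀ t, 0 ≤ t → P (S.toFun t u) = 0) {t : ℝ} (ht : 0 ≤ t) :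
    E (u - Complex.exp (-z * t) • S.orbit u t) = S.truncatedLaplace z u t := by
  obtain ⟨h1, h2⟩ := (S.hasGenerator_truncatedLaplace z u ht).exists_generator_eq
  have h3 := hE ⟨_, h1⟩
  have hPX : P (S.truncatedLaplace z u t) = 0 := by
    rw [truncatedLaplace, ← ContinuousLinearMap.intervalIntegral_comp_comm _
      ((S.continuous_exp_smul_orbit z u).intervalIntegrable _ _)]
    have h0 : ∀ s : ℝ, P (Complex.exp (-z * s) • S.orbit u s) = 0 := fun s => by
      rw [map_smul, orbit, hPu _ (le_max_right s 0), smul_zero]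
    simp only [h0, intervalIntegral.integral_zero]
  rw [h2, sub_sub_cancel, hPX, sub_zero, ← S.orbit_of_nonneg u ht] at h3
  exact h3

/-- Integration by parts in the Laplace transform of an orbit that is multiplied by a cutoff
function `χ`: with `η = χ'`, it is the weak form of `(∂ₜ - A) (χ S u) = χ' S u`. -/
theorem integral_exp_smul_orbit_eq
    (hE : ∀ v : S.generator.domain, E (z • (v : H) - S.generator v) = v - P v)
    (hPu : ∀ t, 0 ≤ t → P (S.toFun t u) = 0) {χ η : ℝ → ℝ} {L : ℝ} (hL : 0 ≤ L) {s : Set ℝ}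
    (hs : s.Countable) (hχ : Continuous χ) (hχη : ∀ t ∈ Ioo 0 L \ s, HasDerivAt χ (η t) t)
    (hη : IntervalIntegrable η volume 0 L) (hχ0 : χ 0 = 0) (hχL : χ L = 0) :
    ∫ t in (0 : ℝ)..L, Complex.exp (-z * t) • χ t • S.orbit u t =
      E (∫ t in (0 : ℝ)..L, Complex.exp (-z * t) • η t • S.orbit u t) := by
  have hX : Continuous (S.truncatedLaplace z u) := continuous_iff_continuousAt.2 fun t =>
    (S.hasDerivAt_truncatedLaplace z u t).continuousAt
  have hY : Continuous fun t => E u - S.truncatedLaplace z u t := continuous_const.sub hX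
  have hd : ∀ t ∈ Ioo 0 L \ s, HasDerivAt (fun t => χ t • (E u - S.truncatedLaplace z u t))
      (η t • (E u - S.truncatedLaplace z u t) - χ t • Complex.exp (-z * t) • S.orbit u t) t := by
    intro t ht
    have := (hχη t ht).smul ((S.hasDerivAt_truncatedLaplace z u t).const_sub (E u))
    convert! this using 1
    rw [smul_neg]
    abel
  have hi1 : IntervalIntegrable (fun t => η t • (E u - S.truncatedLaplace z u t)) volume 0 L :=
    hη.smul_continuousOn hY.continuousOn
  have hi2 : IntervalIntegrable (fun t : ℝ => χ t • Complex.exp (-z * t) • S.orbit u t)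
      volume 0 L := (hχ.smul (S.continuous_exp_smul_orbit z u)).intervalIntegrable _ _
  have h1 := integral_eq_of_hasDerivAt_off_countable_of_le
    (fun t => χ t • (E u - S.truncatedLaplace z u t)) _ hL hs (hχ.smul hY).continuousOn hd
    (hi1.sub hi2)
  rw [intervalIntegral.integral_sub hi1 hi2] at h1
  rw [hχ0, hχL, zero_smul, zero_smul, sub_zero,
    sub_eq_zero] at h1
  have hi3 : IntervalIntegrable (fun t : ℝ => Complex.exp (-z * t) • η t • S.orbit u t)
      volume 0 L := by
    simp only [smul_comm _ (η _)]
    exact hη.smul_continuousOn (S.continuous_exp_smul_orbit z u).continuousOn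
  rw [← ContinuousLinearMap.intervalIntegral_comp_comm _ hi3]
  simp only [smul_comm _ (χ _)]
  rw [← h1]
  refine intervalIntegral.integral_congr fun t ht => ?_
  rw [uIcc_of_le hL] at ht
  simp only [← S.leftInverse_apply_sub_eq_truncatedLaplace hE hPu ht.1, map_sub, sub_sub_cancel,
    map_smul, smul_comm _ (η t)]
  rw [ContinuousLinearMap.map_smul_of_tower, map_smul]

end LeftInverse

section Weighted

variable {H : Type*} [NormedAddCommGroup H] [InnerProductSpace ℂ H] (S : C0Semigroup H)

/-- The orbit of `u`, multiplied by the function `e^{-x t} χ t` on the interval `(0, L]` and cut off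
outside. -/
noncomputable def cutoffOrbit (u : H) (x L : ℝ) (χ : ℝ → ℝ) : ℝ → H :=
  (Ioc 0 L).indicator fun t => (Real.exp (-x * t) * χ t) • S.orbit u t

theorem memLp_cutoffOrbit (u : H) (x L : ℝ) {χ : ℝ → ℝ} (hχ : Measurable χ) {K : ℝ}
    (hK : ∀ t ∈ Ioc 0 L, |χ t| ≤ K) (p : ENNReal) : MemLp (S.cutoffOrbit u x L χ) p := by
  rw [cutoffOrbit, memLp_indicator_iff_restrict measurableSet_Ioc]
  have hc : Continuous fun t => Real.exp (-x * t) • S.orbit u t :=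
    (by fun_prop : Continuous fun t : ℝ => Real.exp (-x * t)).smul (S.continuous_orbit u)
  obtain ⟨B, hB⟩ := (isCompact_Icc (a := 0) (b := L)).exists_bound_of_continuousOn hc.continuousOn
  refine MemLp.of_bound ?_ (K * B) ?_
  · have hm : Measurable fun t => Real.exp (-x * t) * χ t :=
      (by fun_prop : Measurable fun t : ℝ => Real.exp (-x * t)).mul hχ
    exact hm.aestronglyMeasurable.smul (S.continuous_orbit u).aestronglyMeasurable
  · refine (ae_restrict_iff' measurableSet_Ioc).2 (Eventually.of_forall fun t ht => ?_)
    have h1 := hB t (Ioc_subset_Icc_self ht)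
    have h2 := hK t ht
    have h3 : (0 : ℝ) ≤ K := (abs_nonneg _).trans h2
    rw [mul_comm, mul_smul, norm_smul, Real.norm_eq_abs]
    gcongr

theorem fourier_cutoffOrbit (u : H) (x : ℝ) {L : ℝ} (hL : 0 ≤ L) (χ : ℝ → ℝ) (ξ : ℝ) :
    𝓕 (S.cutoffOrbit u x L χ) ξ = ∫ t in (0 : ℝ)..L,
      Complex.exp (-((x : ℂ) + (2 * Real.pi * ξ : ℝ) * Complex.I) * t) • χ t • S.orbit u t := by
  rw [Real.fourier_eq', intervalIntegral.integral_of_le hL,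
    ← integral_indicator measurableSet_Ioc]
  congr 1 with t
  simp only [cutoffOrbit]
  by_cases ht : t ∈ Ioc 0 L
  · rw [indicator_of_mem ht, indicator_of_mem ht, mul_smul, ← Complex.coe_smul (Real.exp _),
      smul_smul, Complex.ofReal_exp, ← Complex.exp_add]
    congr 2
    simp
    ring
  · rw [indicator_of_notMem ht, indicator_of_notMem ht, smul_zero]

theorem integral_norm_sq_cutoffOrbit (u : H) (x : ℝ) {L : ℝ} (hL : 0 ≤ L) (χ : ℝ → ℝ) :
    ∫ t, ‖S.cutoffOrbit u x L χ t‖ ^ 2 =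
      ∫ t in (0 : ℝ)..L, (Real.exp (-x * t) * χ t * ‖S.orbit u t‖) ^ 2 := by
  rw [intervalIntegral.integral_of_le hL, ← integral_indicator measurableSet_Ioc]
  congr 1 with t
  simp only [cutoffOrbit]
  by_cases ht : t ∈ Ioc 0 L
  · rw [indicator_of_mem ht, indicator_of_mem ht, norm_smul, mul_pow, Real.norm_eq_abs, sq_abs,
      ← mul_pow]
  · simp [indicator_of_notMem ht]

/-- The orbit of `u` lies in the weighted space `e^{x·} L²([0, ∞))`. -/
def OrbitSqIntegrable (u : H) (x : ℝ) : Prop :=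
  IntegrableOn (fun t => (Real.exp (-x * t) * ‖S.orbit u t‖) ^ 2) (Ioi 0)

theorem continuous_exp_mul_norm_orbit (u : H) (x : ℝ) :
    Continuous fun t => (Real.exp (-x * t) * ‖S.orbit u t‖) ^ 2 :=
  ((by fun_prop : Continuous fun t => Real.exp (-x * t)).mul (S.continuous_orbit u).norm).pow 2

variable [CompleteSpace H]

/-- The basic weighted estimate, from Plancherel's theorem on the line `Re z = x`, for a cutoff
function `χ` that vanishes at both ends of `[0, L]`, with derivative `η`. -/
theorem integral_weighted_sq_le_of_vanishing {P : H →L[ℂ] H} {x C : ℝ}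
    (hE : ∀ z : ℂ, z.re = x → ∃ E : H →L[ℂ] H, ‖E‖ ≤ C ∧
      ∀ v : S.generator.domain, E (z • (v : H) - S.generator v) = v - P v)
    {u : H} (hPu : ∀ t, 0 ≤ t → P (S.toFun t u) = 0) {χ η : ℝ → ℝ} {L K : ℝ} (hL : 0 ≤ L)
    {s : Set ℝ} (hs : s.Countable) (hχ : Continuous χ)
    (hχη : ∀ t ∈ Ioo 0 L \ s, HasDerivAt χ (η t) t) (hη : Measurable η)
    (hηK : ∀ t ∈ Ioc 0 L, |η t| ≤ K) (hχ0 : χ 0 = 0) (hχL : χ L = 0) :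
    ∫ t in (0 : ℝ)..L, (Real.exp (-x * t) * χ t * ‖S.orbit u t‖) ^ 2 ≤
      C ^ 2 * ∫ t in (0 : ℝ)..L, (Real.exp (-x * t) * η t * ‖S.orbit u t‖) ^ 2 := by
  obtain ⟨B, hB⟩ := (isCompact_Icc (a := 0) (b := L)).exists_bound_of_continuousOn hχ.continuousOn
  have hηi : IntervalIntegrable η volume 0 L := by
    rw [intervalIntegrable_iff_integrableOn_Ioc_of_le hL]
    refine Measure.integrableOn_of_bounded (M := K) (by simp) hη.aestronglyMeasurable ?_
    exact (ae_restrict_iff' measurableSet_Ioc).2 (Eventually.of_forall hηK)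
  have hf := fun p => S.memLp_cutoffOrbit u x L hη hηK p
  have hg := fun p => S.memLp_cutoffOrbit u x L hχ.measurable
    (fun t ht => hB t (Ioc_subset_Icc_self ht)) p
  rw [← S.integral_norm_sq_cutoffOrbit u x hL, ← S.integral_norm_sq_cutoffOrbit u x hL]
  refine integral_norm_sq_le_of_norm_fourier_le (memLp_one_iff_integrable.1 (hf 1)) (hf 2)
    (memLp_one_iff_integrable.1 (hg 1)) (hg 2) fun ξ => ?_
  obtain ⟨E, hEC, hE⟩ := hE ((x : ℂ) + (2 * Real.pi * ξ : ℝ) * Complex.I) (by simp)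
  rw [S.fourier_cutoffOrbit u x hL, S.fourier_cutoffOrbit u x hL,
    S.integral_exp_smul_orbit_eq hE hPu hL hs hχ hχη hηi hχ0 hχL]
  exact E.le_of_opNorm_le hEC _

/-- The weighted estimate without a condition at the right end of `[0, T]`: if the orbit is
square integrable, then `χ` can be continued by a constant to `[T, N]` and taken down to `0` on
`[N, N + 1]`, at a cost that tends to `0` as `N → ∞`. -/
theorem integral_weighted_sq_le {P : H →L[ℂ] H} {x C : ℝ}
    (hE : ∀ z : ℂ, z.re = x → ∃ E : H →L[ℂ] H, ‖E‖ ≤ C ∧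
      ∀ v : S.generator.domain, E (z • (v : H) - S.generator v) = v - P v)
    {u : H} (hPu : ∀ t, 0 ≤ t → P (S.toFun t u) = 0) (hu : S.OrbitSqIntegrable u x)
    {χ η : ℝ → ℝ} {T K : ℝ} (hT : 0 ≤ T)
    {s : Set ℝ} (hs : s.Countable) (hχ : Continuous χ)
    (hχη : ∀ t ∈ Ioo 0 T \ s, HasDerivAt χ (η t) t) (hη : Measurable η)
    (hηK : ∀ t ∈ Ioc 0 T, |η t| ≤ K) (hχ0 : χ 0 = 0) :
    ∫ t in (0 : ℝ)..T, (Real.exp (-x * t) * χ t * ‖S.orbit u t‖) ^ 2 ≤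
      C ^ 2 * ∫ t in (0 : ℝ)..T, (Real.exp (-x * t) * η t * ‖S.orbit u t‖) ^ 2 := by
  set w : ℝ → ℝ := fun t => (Real.exp (-x * t) * ‖S.orbit u t‖) ^ 2 with hw
  have hwc : Continuous w := S.continuous_exp_mul_norm_orbit u x
  have hweq : ∀ (f : ℝ → ℝ) t, (Real.exp (-x * t) * f t * ‖S.orbit u t‖) ^ 2 =
      f t ^ 2 * w t := fun f t => by simp only [hw]; ring
  have key : ∀ N : ℕ, T ≤ N →
      ∫ t in (0 : ℝ)..T, (Real.exp (-x * t) * χ t * ‖S.orbit u t‖) ^ 2 ≤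
      C ^ 2 * ((∫ t in (0 : ℝ)..T, (Real.exp (-x * t) * η t * ‖S.orbit u t‖) ^ 2) +
        χ T ^ 2 * ∫ t in (N : ℝ)..(N + 1), w t) := by
    intro N hTN
    set χ' : ℝ → ℝ := fun t => χ (min t T) * (1 - max (t - N) 0) with hχ'
    set η' : ℝ → ℝ := fun t => if t < T then η t else if t < N then 0 else -χ T with hη'
    have hN1 : (0 : ℝ) ≤ N + 1 := by positivity
    have hχ'c : Continuous χ' := by fun_prop
    have hη'm : Measurable η' := Measurable.ite measurableSet_Iio hη
      (Measurable.ite measurableSet_Iio measurable_const measurable_const)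
    have hder : ∀ t ∈ Ioo (0 : ℝ) (N + 1) \ (s ∪ {T, (N : ℝ)}), HasDerivAt χ' (η' t) t := by
      rintro t ⟨ht, hts⟩
      simp only [mem_union, mem_insert_iff, mem_singleton_iff, not_or] at hts
      obtain ⟨hts, htT, htN⟩ := hts
      rcases lt_or_gt_of_ne htT with h | h
      · have h1 : η' t = η t := if_pos h
        rw [h1]
        refine (hχη t ⟨⟨ht.1, h⟩, hts⟩).congr_of_eventuallyEq ?_
        filter_upwards [gt_mem_nhds h] with r hr
        simp only [hχ']
        rw [min_eq_left hr.le, max_eq_right (by linarith), sub_zero, mul_one]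
      · rcases lt_or_gt_of_ne htN with h' | h'
        · have h1 : η' t = 0 := by simp only [hη']; rw [if_neg h.not_gt, if_pos h']
          rw [h1]
          refine (hasDerivAt_const t (χ T)).congr_of_eventuallyEq ?_
          filter_upwards [lt_mem_nhds h, gt_mem_nhds h'] with r hr hr'
          simp only [hχ']
          rw [min_eq_right hr.le, max_eq_right (by linarith), sub_zero, mul_one]
        · have h1 : η' t = -χ T := by simp only [hη']; rw [if_neg h.not_gt, if_neg h'.not_gt]
          rw [h1]
          have h2 : HasDerivAt (fun r : ℝ => χ T * (1 - (r - N))) (χ T * -1) t :=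
            (((hasDerivAt_id t).sub_const (N : ℝ)).const_sub 1).const_mul (χ T)
          rw [mul_neg_one] at h2
          refine h2.congr_of_eventuallyEq ?_
          filter_upwards [lt_mem_nhds h, lt_mem_nhds h'] with r hr hr'
          simp only [hχ']
          rw [min_eq_right hr.le, max_eq_left (by linarith)]
    have hbd : ∀ t ∈ Ioc (0 : ℝ) (N + 1), |η' t| ≤ max K |χ T| := by
      intro t ht
      simp only [hη']
      split_ifs with h h'
      · exact (hηK t ⟨ht.1, h.le⟩).trans (le_max_left _ _)
      · simp
      · rw [abs_neg]; exact le_max_right _ _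
    have h1 := S.integral_weighted_sq_le_of_vanishing hE hPu hN1
      (hs.union (toFinite {T, (N : ℝ)}).countable) hχ'c hder hη'm hbd
      (by simp [hχ', min_eq_left hT, hχ0]) (by simp [hχ'])
    have hint : ∀ {f : ℝ → ℝ} {B : ℝ}, Measurable f → ∀ a b : ℝ, (∀ t ∈ uIoc a b, |f t| ≤ B) →
        IntervalIntegrable (fun t => (Real.exp (-x * t) * f t * ‖S.orbit u t‖) ^ 2) volume a b := by
      intro f B hf a b hfB
      simp only [hweq]
      have hwi := hwc.intervalIntegrable (μ := volume) a b
      rw [intervalIntegrable_iff] at hwi ⊢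
      refine Integrable.bdd_mul (c := B ^ 2) hwi (hf.pow_const 2).aestronglyMeasurable ?_
      refine (ae_restrict_iff' measurableSet_uIoc).2 (Eventually.of_forall fun t ht => ?_)
      rw [norm_pow, Real.norm_eq_abs]
      have := hfB t ht
      gcongr
    have hintη : ∀ a b : ℝ, 0 ≤ a → a ≤ b → b ≤ N + 1 → IntervalIntegrable
        (fun t => (Real.exp (-x * t) * η' t * ‖S.orbit u t‖) ^ 2) volume a b :=
      fun a b ha hab hb => hint hη'm a b fun t ht => by
        rw [uIoc_of_le hab] at ht
        exact hbd t ⟨by linarith [ht.1], by linarith [ht.2]⟩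
    have hχ'int : ∀ a b : ℝ, IntervalIntegrable
        (fun t => (Real.exp (-x * t) * χ' t * ‖S.orbit u t‖) ^ 2) volume a b := fun a b => by
      simp only [hweq]
      exact ((hχ'c.pow 2).mul hwc).intervalIntegrable a b
    have hleft : ∫ t in (0 : ℝ)..T, (Real.exp (-x * t) * χ t * ‖S.orbit u t‖) ^ 2 ≤
        ∫ t in (0 : ℝ)..(N + 1), (Real.exp (-x * t) * χ' t * ‖S.orbit u t‖) ^ 2 := by
      rw [← intervalIntegral.integral_add_adjacent_intervals (hχ'int 0 T) (hχ'int T (N + 1))]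
      have e1 : ∫ t in (0 : ℝ)..T, (Real.exp (-x * t) * χ t * ‖S.orbit u t‖) ^ 2 =
          ∫ t in (0 : ℝ)..T, (Real.exp (-x * t) * χ' t * ‖S.orbit u t‖) ^ 2 := by
        refine intervalIntegral.integral_congr fun t ht => ?_
        rw [uIcc_of_le hT] at ht
        simp only [hχ']
        rw [min_eq_left ht.2, max_eq_right (by linarith [ht.2]), sub_zero, mul_one]
      have e2 : 0 ≤ ∫ t in T..(N + 1), (Real.exp (-x * t) * χ' t * ‖S.orbit u t‖) ^ 2 :=
        intervalIntegral.integral_nonneg (by linarith) fun t _ => sq_nonneg _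
      linarith
    have hright : ∫ t in (0 : ℝ)..(N + 1), (Real.exp (-x * t) * η' t * ‖S.orbit u t‖) ^ 2 =
        (∫ t in (0 : ℝ)..T, (Real.exp (-x * t) * η t * ‖S.orbit u t‖) ^ 2) +
          χ T ^ 2 * ∫ t in (N : ℝ)..(N + 1), w t := by
      rw [← intervalIntegral.integral_add_adjacent_intervals
          (hintη 0 N le_rfl (by positivity) (by linarith))
          (hintη N (N + 1) (by positivity) (by linarith) le_rfl),
        ← intervalIntegral.integral_add_adjacent_intervals
          (hintη 0 T le_rfl hT (by linarith)) (hintη T N hT hTN (by linarith)),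
        ← intervalIntegral.integral_const_mul]
      have e1 : ∫ t in (0 : ℝ)..T, (Real.exp (-x * t) * η' t * ‖S.orbit u t‖) ^ 2 =
          ∫ t in (0 : ℝ)..T, (Real.exp (-x * t) * η t * ‖S.orbit u t‖) ^ 2 := by
        refine intervalIntegral.integral_congr_Ioo_of_le hT fun t ht => ?_
        simp only [hη']
        rw [if_pos ht.2]
      have e2 : ∫ t in T..(N : ℝ), (Real.exp (-x * t) * η' t * ‖S.orbit u t‖) ^ 2 = 0 := by
        rw [intervalIntegral.integral_congr_Ioo_of_le hTN (g := fun _ => (0 : ℝ)),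
          intervalIntegral.integral_zero]
        intro t ht
        simp only [hη']
        rw [if_neg ht.1.not_gt, if_pos ht.2]
        ring
      have e3 : ∫ t in (N : ℝ)..(N + 1), (Real.exp (-x * t) * η' t * ‖S.orbit u t‖) ^ 2 =
          ∫ t in (N : ℝ)..(N + 1), χ T ^ 2 * w t := by
        refine intervalIntegral.integral_congr_Ioo_of_le (by linarith) fun t ht => ?_
        simp only [hη', hw]
        rw [if_neg (hTN.trans ht.1.le).not_gt, if_neg ht.1.not_gt]
        ring
      rw [e1, e2, e3, add_zero]
    rw [hright] at h1
    exact hleft.trans h1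
  have hlim : Tendsto (fun N : ℕ => ∫ t in (N : ℝ)..(N + 1), w t) atTop (𝓝 0) := by
    have h1 := intervalIntegral_tendsto_integral_Ioi (f := w) 0 hu
      tendsto_natCast_atTop_atTop (l := (atTop : Filter ℕ))
    have h2 := h1.comp (tendsto_add_atTop_nat 1)
    have h3 := h2.sub h1
    rw [sub_self] at h3
    refine h3.congr fun N => ?_
    simp only [Function.comp_apply, Nat.cast_add, Nat.cast_one]
    exact intervalIntegral.integral_interval_sub_left (hwc.intervalIntegrable _ _)
      (hwc.intervalIntegrable _ _)
  have hlim2 := ((hlim.const_mul (χ T ^ 2)).const_add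
    (∫ t in (0 : ℝ)..T, (Real.exp (-x * t) * η t * ‖S.orbit u t‖) ^ 2)).const_mul (C ^ 2)
  rw [mul_zero, add_zero] at hlim2
  refine ge_of_tendsto hlim2 ?_
  filter_upwards [tendsto_natCast_atTop_atTop.eventually_ge_atTop T] with N hN using key N hN

end Weighted

end C0Semigroup

/-! ### Square integrability and decay of orbits -/

namespace C0Semigroup

open MeasureTheory

section Decay

variable {H : Type*} [NormedAddCommGroup H] [InnerProductSpace ℂ H] (S : C0Semigroup H)

/-- The growth bound of the semigroup gives square integrability for large exponents. -/
theorem orbitSqIntegrable_of_norm_le {M c x : ℝ}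
    (hM : ∀ t, 0 ≤ t → ‖S.toFun t‖ ≤ M * Real.exp (c * t)) (hx : c < x) (u : H) :
    S.OrbitSqIntegrable u x := by
  have h1 : IntegrableOn (fun t => (M * ‖u‖) ^ 2 * Real.exp (-(2 * (x - c)) * t)) (Ioi 0) :=
    (exp_neg_integrableOn_Ioi 0 (by linarith)).const_mul _
  refine Integrable.mono' h1 (S.continuous_exp_mul_norm_orbit u x).aestronglyMeasurable ?_
  refine (ae_restrict_iff' measurableSet_Ioi).2 (Eventually.of_forall fun t ht => ?_)
  have ht0 : 0 ≤ t := le_of_lt ht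
  rw [Real.norm_of_nonneg (sq_nonneg _), S.orbit_of_nonneg u ht0]
  calc (Real.exp (-x * t) * ‖S.toFun t u‖) ^ 2
      ≤ (Real.exp (-x * t) * (M * Real.exp (c * t) * ‖u‖)) ^ 2 := by
        have := (S.toFun t).le_of_opNorm_le (hM t ht0) u
        gcongr
    _ = (M * ‖u‖) ^ 2 * (Real.exp (-x * t) * Real.exp (c * t)) ^ 2 := by ring
    _ = _ := by
        rw [← Real.exp_add, ← Real.exp_nat_mul]
        congr 2
        push_cast
        ring

variable [CompleteSpace H]

/-- The weighted estimate improves square integrability by a fixed amount in the exponent: the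
cutoff function `e^{δ (t - 1)}` on `[1, T]` has the derivative `δ e^{δ (t - 1)}`, so that for small
`δ` the corresponding term can be absorbed. -/
theorem OrbitSqIntegrable.sub {P : H →L[ℂ] H} {x C : ℝ}
    (hE : ∀ z : ℂ, z.re = x → ∃ E : H →L[ℂ] H, ‖E‖ ≤ C ∧
      ∀ v : S.generator.domain, E (z • (v : H) - S.generator v) = v - P v)
    {u : H} (hPu : ∀ t, 0 ≤ t → P (S.toFun t u) = 0) (hu : S.OrbitSqIntegrable u x)
    {δ : ℝ} (hCδ : C ^ 2 * δ ^ 2 ≤ 1 / 2) :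
    S.OrbitSqIntegrable u (x - δ) := by
  set χ : ℝ → ℝ := fun t => if t ≤ 1 then t else Real.exp (δ * (t - 1)) with hχ
  set η : ℝ → ℝ := fun t => if t ≤ 1 then 1 else δ * Real.exp (δ * (t - 1)) with hη
  have hχc : Continuous χ := Continuous.if_le continuous_id (by fun_prop) continuous_id
    continuous_const fun t ht => by simp [ht]
  have hηm : Measurable η := Measurable.ite measurableSet_Iic measurable_const (by fun_prop)
  have hder : ∀ t, t ≠ 1 → HasDerivAt χ (η t) t := by
    intro t ht
    rcases lt_or_gt_of_ne ht with h | h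
    · rw [show η t = 1 from if_pos h.le]
      refine (hasDerivAt_id t).congr_of_eventuallyEq ?_
      filter_upwards [gt_mem_nhds h] with r hr
      exact if_pos hr.le
    · rw [show η t = δ * Real.exp (δ * (t - 1)) from if_neg h.not_ge]
      have h1 : HasDerivAt (fun r : ℝ => Real.exp (δ * (r - 1)))
          (Real.exp (δ * (t - 1)) * (δ * 1)) t :=
        (((hasDerivAt_id t).sub_const 1).const_mul δ).exp
      rw [mul_one, mul_comm] at h1
      refine h1.congr_of_eventuallyEq ?_
      filter_upwards [lt_mem_nhds h] with r hr
      exact if_neg hr.not_ge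
  have hwc := S.continuous_exp_mul_norm_orbit u x
  have hwδ := S.continuous_exp_mul_norm_orbit u (x - δ)
  set D : ℝ := 2 * (C ^ 2 * ∫ t in (0 : ℝ)..1, (Real.exp (-x * t) * ‖S.orbit u t‖) ^ 2) with hD
  have key : ∀ T : ℝ, 1 ≤ T → ∫ t in (1 : ℝ)..T,
      (Real.exp (-x * t) * Real.exp (δ * (t - 1)) * ‖S.orbit u t‖) ^ 2 ≤ D := by
    intro T hT
    set J := ∫ t in (1 : ℝ)..T,
      (Real.exp (-x * t) * Real.exp (δ * (t - 1)) * ‖S.orbit u t‖) ^ 2 with hJ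
    have hJc : Continuous fun t =>
        (Real.exp (-x * t) * Real.exp (δ * (t - 1)) * ‖S.orbit u t‖) ^ 2 := by
      have := S.continuous_orbit u
      fun_prop
    have hχi : ∀ a b : ℝ, IntervalIntegrable
        (fun t => (Real.exp (-x * t) * χ t * ‖S.orbit u t‖) ^ 2) volume a b := fun a b => by
      have := S.continuous_orbit u
      exact Continuous.intervalIntegrable (by fun_prop) a b
    have h1 := S.integral_weighted_sq_le hE hPu hu (T := T) (by linarith)
      (countable_singleton (1 : ℝ)) hχc (fun t ht => hder t ht.2) hηm
      (K := max 1 (|δ| * Real.exp (|δ| * T))) (fun t ht => by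
        simp only [hη]
        split_ifs with h
        · simp
        · refine le_trans ?_ (le_max_right _ _)
          rw [abs_mul, abs_of_pos (Real.exp_pos _)]
          have h2 : δ * (t - 1) ≤ |δ| * T :=
            mul_le_mul (le_abs_self δ) (by linarith [ht.2]) (by linarith [not_le.1 h])
              (abs_nonneg δ)
          gcongr) (by simp [hχ])
    have e1 : ∫ t in (0 : ℝ)..1, (Real.exp (-x * t) * η t * ‖S.orbit u t‖) ^ 2 =
        ∫ t in (0 : ℝ)..1, (Real.exp (-x * t) * ‖S.orbit u t‖) ^ 2 := by
      refine intervalIntegral.integral_congr_Ioo_of_le zero_le_one fun t ht => ?_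
      simp only [hη]
      rw [if_pos ht.2.le, mul_one]
    have e2 : EqOn (fun t => (Real.exp (-x * t) * η t * ‖S.orbit u t‖) ^ 2)
        (fun t => δ ^ 2 * (Real.exp (-x * t) * Real.exp (δ * (t - 1)) * ‖S.orbit u t‖) ^ 2)
        (Ioc 1 T) := by
      intro t ht
      simp only [hη]
      rw [if_neg ht.1.not_ge]
      ring
    have hη1 : IntervalIntegrable
        (fun t => (Real.exp (-x * t) * η t * ‖S.orbit u t‖) ^ 2) volume 0 1 := by
      refine (hwc.intervalIntegrable 0 1).congr fun t ht => ?_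
      rw [uIoc_of_le zero_le_one] at ht
      simp only [hη]
      rw [if_pos ht.2, mul_one]
    have hη2 : IntervalIntegrable
        (fun t => (Real.exp (-x * t) * η t * ‖S.orbit u t‖) ^ 2) volume 1 T := by
      refine ((hJc.intervalIntegrable 1 T).const_mul (δ ^ 2)).congr fun t ht => ?_
      rw [uIoc_of_le hT] at ht
      exact (e2 ht).symm
    rw [← intervalIntegral.integral_add_adjacent_intervals (hχi 0 1) (hχi 1 T),
      ← intervalIntegral.integral_add_adjacent_intervals hη1 hη2, e1,
      intervalIntegral.integral_congr_Ioo_of_le hT (e2.mono Ioo_subset_Ioc_self),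
      intervalIntegral.integral_const_mul, ← hJ] at h1
    have e3 : ∫ t in (1 : ℝ)..T, (Real.exp (-x * t) * χ t * ‖S.orbit u t‖) ^ 2 = J := by
      refine intervalIntegral.integral_congr_Ioo_of_le hT fun t ht => ?_
      simp only [hχ]
      rw [if_neg ht.1.not_ge]
    have e4 : 0 ≤ ∫ t in (0 : ℝ)..1, (Real.exp (-x * t) * χ t * ‖S.orbit u t‖) ^ 2 :=
      intervalIntegral.integral_nonneg zero_le_one fun t _ => sq_nonneg _
    have e5 : 0 ≤ J := intervalIntegral.integral_nonneg hT fun t _ => sq_nonneg _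
    have e6 : C ^ 2 * δ ^ 2 * J ≤ 1 / 2 * J := mul_le_mul_of_nonneg_right hCδ e5
    rw [e3] at h1
    linarith
  have hIoi1 : IntegrableOn (fun t => (Real.exp (-(x - δ) * t) * ‖S.orbit u t‖) ^ 2) (Ioi 1) := by
    refine integrableOn_Ioi_of_intervalIntegral_norm_bounded (l := atTop) (b := id)
      (Real.exp (2 * δ) * D) 1 (fun T => hwδ.integrableOn_Ioc) tendsto_id ?_
    filter_upwards [eventually_ge_atTop 1] with T hT
    have h1 : ∀ t : ℝ, ‖(Real.exp (-(x - δ) * t) * ‖S.orbit u t‖) ^ 2‖ =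
        Real.exp (2 * δ) *
          (Real.exp (-x * t) * Real.exp (δ * (t - 1)) * ‖S.orbit u t‖) ^ 2 := fun t => by
      rw [Real.norm_of_nonneg (sq_nonneg _), mul_pow, mul_pow, ← mul_assoc, ← Real.exp_add,
        ← Real.exp_nat_mul, ← Real.exp_nat_mul, ← Real.exp_add]
      congr 2
      push_cast
      ring
    simp only [h1, id]
    rw [intervalIntegral.integral_const_mul]
    have := key T hT
    gcongr
  rw [OrbitSqIntegrable, ← Ioc_union_Ioi_eq_Ioi zero_le_one]
  exact hwδ.integrableOn_Ioc.union hIoi1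

/-- If `z - A` has uniformly bounded left inverses modulo `P` for `Re z ≥ x`, then the orbits in
the kernel of `P` are square integrable with weight `e^{-x t}`. -/
theorem orbitSqIntegrable_of_leftInverse {P : H →L[ℂ] H} {x M c C : ℝ}
    (hM : ∀ t, 0 ≤ t → ‖S.toFun t‖ ≤ M * Real.exp (c * t))
    (hE : ∀ z : ℂ, x ≤ z.re → ∃ E : H →L[ℂ] H, ‖E‖ ≤ C ∧
      ∀ v : S.generator.domain, E (z • (v : H) - S.generator v) = v - P v)
    {u : H} (hPu : ∀ t, 0 ≤ t → P (S.toFun t u) = 0) : S.OrbitSqIntegrable u x := by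
  set d := max (c + 1 - x) 0 with hd
  have hd0 : 0 ≤ d := le_max_right _ _
  have hdc : c < x + d := by linarith [le_max_left (c + 1 - x) 0]
  -- `k` steps of length `d / k` lead from `x + d` to `x`, each short enough for the absorption
  obtain ⟨k, hk⟩ := exists_nat_gt (2 * C ^ 2 * d ^ 2 + 1)
  have hCd : 0 ≤ 2 * C ^ 2 * d ^ 2 := by positivity
  have hk1 : (1 : ℝ) < k := by linarith
  have hk0 : (0 : ℝ) < k := by linarith
  have hCδ : C ^ 2 * (d / k) ^ 2 ≤ 1 / 2 := by
    rw [div_pow, ← mul_div_assoc, div_le_iff₀ (by positivity)]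
    nlinarith
  have hstep : ∀ i : ℕ, i ≤ k → S.OrbitSqIntegrable u (x + d - i * (d / k)) := by
    intro i
    induction i with
    | zero =>
      intro _
      simpa using S.orbitSqIntegrable_of_norm_le hM hdc u
    | succ i ih =>
      intro hi
      have h1 := ih (by omega)
      have hx : x ≤ x + d - i * (d / k) := by
        have : (i : ℝ) * (d / k) ≤ d := by
          rw [← mul_div_assoc, div_le_iff₀ hk0, mul_comm]
          have : (i : ℝ) ≤ k := by exact_mod_cast (by omega : i ≤ k)
          gcongr
        linarith
      have h2 := OrbitSqIntegrable.sub S (fun z hz => hE z (hz ▸ hx)) hPu h1 hCδ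
      convert! h2 using 1
      push_cast
      ring
  have := hstep k le_rfl
  have h2 : (k : ℝ) * (d / k) = d := by field_simp
  rwa [h2, add_sub_cancel_right] at this

end Decay

section Bound

variable {H : Type*} [NormedAddCommGroup H] [InnerProductSpace ℂ H]
  (S : C0Semigroup H)

theorem weightedL2Norm_sq (x : ℝ) {a : ℝ} (ha : 0 ≤ a) (f : ℝ → ℝ) :
    weightedL2Norm x a f ^ 2 = ∫ s in (0 : ℝ)..a, (Real.exp (x * s) * f s) ^ 2 :=
  Real.sq_sqrt (intervalIntegral.integral_nonneg ha fun _ _ => sq_nonneg _)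

/-- The pointwise bound on an orbit in terms of its square integral over `[a, a + b]`, from
`‖S t u‖ ≤ m (t - s) ‖S s u‖`. -/
theorem norm_toFun_mul_weightedL2Norm_le {m : ℝ → ℝ} (hm_cont : Continuous m)
    (hm_pos : ∀ t, 0 < m t) (hm : ∀ t, 0 ≤ t → ‖S.toFun t‖ ≤ m t) (x : ℝ) {a b : ℝ}
    (ha : 0 ≤ a) (hb : 0 ≤ b) (u : H) :
    (‖S.toFun (a + b) u‖ * weightedL2Norm x b fun s => 1 / m s) ^ 2 ≤
      Real.exp (x * (a + b)) ^ 2 *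
        ∫ s in a..(a + b), (Real.exp (-x * s) * ‖S.orbit u s‖) ^ 2 := by
  have hc : Continuous fun s => (Real.exp (x * s) * (1 / m s)) ^ 2 :=
    ((by fun_prop : Continuous fun s => Real.exp (x * s)).mul
      (continuous_const.div hm_cont fun t => (hm_pos t).ne')).pow 2
  have h1 : ∫ s in (0 : ℝ)..b, (Real.exp (x * s) * (1 / m s)) ^ 2 =
      ∫ s in a..(a + b), (Real.exp (x * (a + b - s)) * (1 / m (a + b - s))) ^ 2 := by
    rw [intervalIntegral.integral_comp_sub_left
      (fun s => (Real.exp (x * s) * (1 / m s)) ^ 2) (a + b)]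
    simp
  rw [mul_pow, weightedL2Norm_sq x hb, h1, ← intervalIntegral.integral_const_mul,
    ← intervalIntegral.integral_const_mul]
  refine intervalIntegral.integral_mono_on (by linarith) ?_ ?_ fun s hs => ?_
  · exact ((hc.comp (continuous_const.sub continuous_id)).const_mul _).intervalIntegrable _ _
  · exact ((S.continuous_exp_mul_norm_orbit u x).const_mul _).intervalIntegrable _ _
  · have hs0 : 0 ≤ s := ha.trans hs.1
    have hts : 0 ≤ a + b - s := by linarith [hs.2]
    have h2 : ‖S.toFun (a + b) u‖ ≤ m (a + b - s) * ‖S.orbit u s‖ := by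
      rw [S.orbit_of_nonneg u hs0]
      have h3 := S.map_add (a + b - s) s hts hs0
      rw [sub_add_cancel] at h3
      rw [h3]
      exact (S.toFun (a + b - s)).le_of_opNorm_le (hm _ hts) _
    have hmp := hm_pos (a + b - s)
    have h4 : ‖S.toFun (a + b) u‖ * (1 / m (a + b - s)) ≤ ‖S.orbit u s‖ := by
      rw [mul_one_div, div_le_iff₀ hmp, mul_comm]
      exact h2
    have h5 : Real.exp (x * (a + b)) * Real.exp (-x * s) = Real.exp (x * (a + b - s)) := by
      rw [← Real.exp_add]
      congr 1
      ring
    rw [← mul_pow, ← mul_pow]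
    have h0 : 0 ≤ ‖S.toFun (a + b) u‖ * (1 / m (a + b - s)) := by positivity
    calc (‖S.toFun (a + b) u‖ * (Real.exp (x * (a + b - s)) * (1 / m (a + b - s)))) ^ 2
        = (Real.exp (x * (a + b - s)) * (‖S.toFun (a + b) u‖ * (1 / m (a + b - s)))) ^ 2 := by
          ring
      _ ≤ (Real.exp (x * (a + b - s)) * ‖S.orbit u s‖) ^ 2 := by gcongr
      _ = _ := by rw [← h5]; ring

variable [CompleteSpace H]

/-- The square integral of an orbit after time `a`, from the weighted estimate with the cutoff
function whose derivative is `e^{2 x s} / m(s)²` on `[0, a]` and `0` afterwards. This choice of the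
derivative minimizes the right-hand side for a given value of the cutoff function at `a`. -/
theorem weightedL2Norm_mul_integral_le {m : ℝ → ℝ} (hm_cont : Continuous m)
    (hm_pos : ∀ t, 0 < m t) (hm : ∀ t, 0 ≤ t → ‖S.toFun t‖ ≤ m t) {x C : ℝ}
    (hE : ∀ z : ℂ, z.re = x → ∃ E : H →L[ℂ] H, ‖E‖ ≤ C ∧
      ∀ v : S.generator.domain, E (z • (v : H) - S.generator v) = v)
    {u : H} (hu : S.OrbitSqIntegrable u x) {a b : ℝ} (ha : 0 < a) (hb : 0 ≤ b) :
    (weightedL2Norm x a fun s => 1 / m s) ^ 2 *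
      ∫ s in a..(a + b), (Real.exp (-x * s) * ‖S.orbit u s‖) ^ 2 ≤ C ^ 2 * ‖u‖ ^ 2 := by
  set k : ℝ → ℝ := fun s => (Real.exp (x * s) * (1 / m s)) ^ 2 with hk
  have hkc : Continuous k :=
    ((by fun_prop : Continuous fun s => Real.exp (x * s)).mul
      (continuous_const.div hm_cont fun t => (hm_pos t).ne')).pow 2
  set I := ∫ s in (0 : ℝ)..a, k s with hI
  have hIpos : 0 < I := intervalIntegral.intervalIntegral_pos_of_pos (hkc.intervalIntegrable _ _)
    (fun s => by have := hm_pos s; positivity) ha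
  rw [weightedL2Norm_sq x ha.le, ← hI]
  set F : ℝ → ℝ := fun t => ∫ s in (0 : ℝ)..t, k s with hF
  have hFd : ∀ t, HasDerivAt F (k t) t := fun t =>
    (hkc.integral_hasStrictDerivAt 0 t).hasDerivAt
  have hFc : Continuous F := continuous_iff_continuousAt.2 fun t => (hFd t).continuousAt
  set χ : ℝ → ℝ := fun t => F (min t a) with hχ
  set η : ℝ → ℝ := fun t => if t < a then k t else 0 with hη
  have hχc : Continuous χ := by fun_prop
  have hηm : Measurable η := Measurable.ite measurableSet_Iio hkc.measurable measurable_const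
  have hder : ∀ t, t ≠ a → HasDerivAt χ (η t) t := by
    intro t ht
    rcases lt_or_gt_of_ne ht with h | h
    · rw [show η t = k t from if_pos h]
      refine (hFd t).congr_of_eventuallyEq ?_
      filter_upwards [gt_mem_nhds h] with r hr
      simp only [hχ, min_eq_left hr.le]
    · rw [show η t = 0 from if_neg h.not_gt]
      refine (hasDerivAt_const t (F a)).congr_of_eventuallyEq ?_
      filter_upwards [lt_mem_nhds h] with r hr
      simp only [hχ, min_eq_right hr.le]
  obtain ⟨K, hK⟩ := (isCompact_Icc (a := 0) (b := a)).exists_bound_of_continuousOn hkc.continuousOn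
  have hηK : ∀ t ∈ Ioc 0 (a + b), |η t| ≤ K := by
    intro t ht
    simp only [hη]
    split_ifs with h
    · exact hK t ⟨ht.1.le, h.le⟩
    · rw [abs_zero]; exact (norm_nonneg _).trans (hK 0 ⟨le_rfl, ha.le⟩)
  have h1 := S.integral_weighted_sq_le (P := 0) (T := a + b) (fun z hz => by simpa using hE z hz)
    (fun t _ => by simp) hu (by linarith) (countable_singleton a) hχc (fun t ht => hder t ht.2)
    hηm hηK (by simp [hχ, hF, min_eq_left ha.le])
  have horb := S.continuous_orbit u
  have hχi : ∀ p q : ℝ, IntervalIntegrable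
      (fun t => (Real.exp (-x * t) * χ t * ‖S.orbit u t‖) ^ 2) volume p q := fun p q =>
    Continuous.intervalIntegrable (by fun_prop) p q
  have e1 : I ^ 2 * ∫ s in a..(a + b), (Real.exp (-x * s) * ‖S.orbit u s‖) ^ 2 ≤
      ∫ t in (0 : ℝ)..(a + b), (Real.exp (-x * t) * χ t * ‖S.orbit u t‖) ^ 2 := by
    rw [← intervalIntegral.integral_add_adjacent_intervals (hχi 0 a) (hχi a (a + b)),
      ← intervalIntegral.integral_const_mul]
    have e2 : 0 ≤ ∫ t in (0 : ℝ)..a, (Real.exp (-x * t) * χ t * ‖S.orbit u t‖) ^ 2 :=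
      intervalIntegral.integral_nonneg ha.le fun t _ => sq_nonneg _
    refine le_trans (le_of_eq ?_) (le_add_of_nonneg_left e2)
    refine intervalIntegral.integral_congr fun t ht => ?_
    rw [uIcc_of_le (by linarith)] at ht
    simp only [hχ, min_eq_right ht.1]
    ring
  have hηi : ∀ {p q : ℝ}, 0 ≤ p → p ≤ q → q ≤ a + b → IntervalIntegrable
      (fun t => (Real.exp (-x * t) * η t * ‖S.orbit u t‖) ^ 2) volume p q := by
    intro p q hp hpq hq
    have hw := (S.continuous_exp_mul_norm_orbit u x).intervalIntegrable (μ := volume) p q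
    have h2 : (fun t => (Real.exp (-x * t) * η t * ‖S.orbit u t‖) ^ 2) =
        fun t => η t ^ 2 * (Real.exp (-x * t) * ‖S.orbit u t‖) ^ 2 := by
      ext t
      ring
    rw [h2]
    rw [intervalIntegrable_iff] at hw ⊢
    refine Integrable.bdd_mul (c := K ^ 2) hw (hηm.pow_const 2).aestronglyMeasurable ?_
    refine (ae_restrict_iff' measurableSet_uIoc).2 (Eventually.of_forall fun t ht => ?_)
    rw [uIoc_of_le hpq] at ht
    rw [norm_pow, Real.norm_eq_abs]
    have := hηK t ⟨by linarith [ht.1], by linarith [ht.2]⟩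
    gcongr
  have e3 : ∫ t in (0 : ℝ)..(a + b), (Real.exp (-x * t) * η t * ‖S.orbit u t‖) ^ 2 ≤
      ‖u‖ ^ 2 * I := by
    rw [← intervalIntegral.integral_add_adjacent_intervals
      (hηi le_rfl ha.le (by linarith)) (hηi ha.le (by linarith) le_rfl)]
    have e4 : ∫ t in a..(a + b), (Real.exp (-x * t) * η t * ‖S.orbit u t‖) ^ 2 = 0 := by
      rw [intervalIntegral.integral_congr (g := fun _ => (0 : ℝ)),
        intervalIntegral.integral_zero]
      intro t ht
      rw [uIcc_of_le (by linarith)] at ht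
      simp only [hη, if_neg ht.1.not_gt]
      ring
    rw [e4, add_zero, hI, ← intervalIntegral.integral_const_mul]
    refine intervalIntegral.integral_mono_on_of_le_Ioo ha.le
      (hηi le_rfl ha.le (by linarith)) ((hkc.const_mul _).intervalIntegrable _ _) fun t ht => ?_
    have hmp := hm_pos t
    simp only [hη, if_pos ht.2]
    rw [S.orbit_of_nonneg u ht.1.le]
    have h3 : ‖S.toFun t u‖ ≤ m t * ‖u‖ := (S.toFun t).le_of_opNorm_le (hm t ht.1.le) u
    calc (Real.exp (-x * t) * k t * ‖S.toFun t u‖) ^ 2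
        ≤ (Real.exp (-x * t) * k t * (m t * ‖u‖)) ^ 2 := by
          have : 0 ≤ k t := sq_nonneg _
          gcongr
      _ = (Real.exp (-x * t) * Real.exp (x * t)) ^ 2 * (‖u‖ ^ 2 * k t) := by
          simp only [hk]
          field_simp
      _ = ‖u‖ ^ 2 * k t := by
          rw [← Real.exp_add]
          simp
  have h5 : I ^ 2 * ∫ s in a..(a + b), (Real.exp (-x * s) * ‖S.orbit u s‖) ^ 2 ≤
      C ^ 2 * (‖u‖ ^ 2 * I) := e1.trans (h1.trans (by gcongr))
  refine le_of_mul_le_mul_left ?_ hIpos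
  calc I * (I * ∫ s in a..(a + b), (Real.exp (-x * s) * ‖S.orbit u s‖) ^ 2)
      = I ^ 2 * ∫ s in a..(a + b), (Real.exp (-x * s) * ‖S.orbit u s‖) ^ 2 := by ring
    _ ≤ C ^ 2 * (‖u‖ ^ 2 * I) := h5
    _ = I * (C ^ 2 * ‖u‖ ^ 2) := by ring

end Bound

end C0Semigroup

/-! ### The bound in terms of the line radius -/

namespace C0Semigroup

variable {H : Type*} [NormedAddCommGroup H] [InnerProductSpace ℂ H] [CompleteSpace H]
  (S : C0Semigroup H)

theorem weightedL2Norm_pos {m : ℝ → ℝ} (hm_cont : Continuous m) (hm_pos : ∀ t, 0 < m t) (x : ℝ)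
    {a : ℝ} (ha : 0 < a) : 0 < weightedL2Norm x a fun s => 1 / m s := by
  have hc : Continuous fun s => (Real.exp (x * s) * (1 / m s)) ^ 2 :=
    ((by fun_prop : Continuous fun s => Real.exp (x * s)).mul
      (continuous_const.div hm_cont fun t => (hm_pos t).ne')).pow 2
  exact Real.sqrt_pos.2 (intervalIntegral.intervalIntegral_pos_of_pos
    (hc.intervalIntegrable _ _) (fun s => by have := hm_pos s; positivity) ha)

/-- The bound on an orbit of which square integrability with weight `e^{-x t}` is already known. -/
theorem norm_toFun_le_of_orbitSqIntegrable {m : ℝ → ℝ} (hm_cont : Continuous m)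
    (hm_pos : ∀ t, 0 < m t) (hm : ∀ t, 0 ≤ t → ‖S.toFun t‖ ≤ m t) {x C : ℝ} (hC : 0 ≤ C)
    (hE : ∀ z : ℂ, z.re = x → ∃ E : H →L[ℂ] H, ‖E‖ ≤ C ∧
      ∀ v : S.generator.domain, E (z • (v : H) - S.generator v) = v)
    {u : H} (hu : S.OrbitSqIntegrable u x) {a b : ℝ} (ha : 0 < a) (hb : 0 < b) :
    ‖S.toFun (a + b) u‖ ≤ Real.exp (x * (a + b)) * C /
      ((weightedL2Norm x a fun s => 1 / m s) * (weightedL2Norm x b fun s => 1 / m s)) * ‖u‖ := by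
  have h1 := S.norm_toFun_mul_weightedL2Norm_le hm_cont hm_pos hm x ha.le hb.le u
  have h2 := S.weightedL2Norm_mul_integral_le hm_cont hm_pos hm hE hu ha hb.le
  have hWa := weightedL2Norm_pos hm_cont hm_pos x ha
  have hWb := weightedL2Norm_pos hm_cont hm_pos x hb
  set Wa := weightedL2Norm x a fun s => 1 / m s
  set Wb := weightedL2Norm x b fun s => 1 / m s
  rw [div_mul_eq_mul_div, le_div_iff₀ (by positivity)]
  refine (sq_le_sq₀ (by positivity) (by positivity)).1 ?_
  set J := ∫ s in a..(a + b), (Real.exp (-x * s) * ‖S.orbit u s‖) ^ 2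
  calc (‖S.toFun (a + b) u‖ * (Wa * Wb)) ^ 2
      = Wa ^ 2 * (‖S.toFun (a + b) u‖ * Wb) ^ 2 := by ring
    _ ≤ Wa ^ 2 * (Real.exp (x * (a + b)) ^ 2 * J) := by gcongr
    _ = Real.exp (x * (a + b)) ^ 2 * (Wa ^ 2 * J) := by ring
    _ ≤ Real.exp (x * (a + b)) ^ 2 * (C ^ 2 * ‖u‖ ^ 2) := by gcongr
    _ = (Real.exp (x * (a + b)) * C * ‖u‖) ^ 2 := by ring

end C0Semigroup

theorem theorem1p5 {H : Type*} [NormedAddCommGroup H] [InnerProductSpace ℂ H] [CompleteSpace H]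
    (S : C0Semigroup H) (ω : ℝ)
    (hω : UnboundedOperator.ResolventBoundedOn S.generator {z | ω ≤ z.re})
    (m : ℝ → ℝ) (hm_cont : ContinuousOn m (Ici 0)) (hm_pos : ∀ t, 0 ≤ t → 0 < m t)
    (hm : ∀ t, 0 ≤ t → ‖S.toFun t‖ ≤ m t)
    (ω' : ℝ) (hω' : ω' < ω)
    (h_line : ∀ z ∈ UnboundedOperator.spectrum S.generator, z.re ≠ ω')
    (h_compact : IsCompact (UnboundedOperator.spectrumRight S.generator ω'))
    (h_bdd : ∀ U ∈ 𝓝ˢ (UnboundedOperator.spectrumRight S.generator ω'),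
      UnboundedOperator.ResolventBoundedOn S.generator ({z | ω' ≤ z.re} \ U))
    (V : Set ℂ) (n : ℕ) (γ : Fin n → ℝ → ℂ)
    (hV : IsRieszContour (UnboundedOperator.spectrum S.generator)
      (UnboundedOperator.spectrumRight S.generator ω') V γ)
    (P : H →L[ℂ] H) (hP : P = UnboundedOperator.rieszIntegral S.generator γ) :
    P ∘L P = P ∧
    (∀ (V' : Set ℂ) (n' : ℕ) (γ' : Fin n' → ℝ → ℂ),
      IsRieszContour (UnboundedOperator.spectrum S.generator)
        (UnboundedOperator.spectrumRight S.generator ω') V' γ' →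
      UnboundedOperator.rieszIntegral S.generator γ' = P) ∧
    ∃ R : ℝ → H →L[ℂ] H, ∀ t : ℝ, 0 < t →
      S.toFun t = S.toFun t ∘L P + R t ∧
      R t = S.toFun t ∘L (ContinuousLinearMap.id ℂ H - P) ∧
      ∀ a b : ℝ, 0 < a → 0 < b → a + b = t →
        ‖R t‖ ≤ Real.exp (ω' * t) /
            (UnboundedOperator.lineRadius S.generator ω' *
              weightedL2Norm ω' a (fun s => 1 / m s) *
              weightedL2Norm ω' b (fun s => 1 / m s)) *
          ‖ContinuousLinearMap.id ℂ H - P‖ := by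
  have hz₀ : ((ω : ℝ) : ℂ) ∈ UnboundedOperator.resolventSet S.generator := hω.1 (by simp)
  have hPP : P ∘L P = P := hP ▸ hV.rieszIntegral_comp_self ⟨_, hz₀⟩
  refine ⟨hPP, fun V' n' γ' hV' => hP ▸ hV.rieszIntegral_eq hV' ⟨_, hz₀⟩,
    fun t => S.toFun t ∘L (ContinuousLinearMap.id ℂ H - P), fun t ht => ⟨?_, rfl, ?_⟩⟩
  · ext v
    simp
  intro a b ha hb hab
  -- the resolvent on the line `Re z = ω'`
  have hhalf : {z : ℂ | ω' < z.re} ∈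
      𝓝ˢ (UnboundedOperator.spectrumRight S.generator ω') :=
    (isOpen_lt continuous_const Complex.continuous_re).mem_nhdsSet.2 fun z hz => hz.2
  obtain ⟨hlsub, C₀, hC₀⟩ := h_bdd _ hhalf
  have hline_mem : ∀ z : ℂ, z.re = ω' → z ∈ {z : ℂ | ω' ≤ z.re} \ {z : ℂ | ω' < z.re} :=
    fun z hz => ⟨hz.ge, by simp [hz]⟩
  set C := sSup ((fun z : ℂ => ‖UnboundedOperator.resolvent S.generator z‖) '' {z | z.re = ω'})
    with hC
  have hCle : ∀ z : ℂ, z.re = ω' → ‖UnboundedOperator.resolvent S.generator z‖ ≤ C :=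
    fun z hz => le_csSup ⟨C₀, by rintro _ ⟨w, hw, rfl⟩; exact hC₀ w (hline_mem w hw)⟩
      (mem_image_of_mem _ hz)
  have hC_nonneg : 0 ≤ C := (norm_nonneg _).trans (hCle ω' (by simp))
  have hE : ∀ z : ℂ, z.re = ω' → ∃ E : H →L[ℂ] H, ‖E‖ ≤ C ∧
      ∀ v : S.generator.domain, E (z • (v : H) - S.generator v) = v := fun z hz =>
    ⟨_, hCle z hz, (UnboundedOperator.isResolventAt_resolvent (hlsub (hline_mem z hz))).2⟩
  -- square integrability of the orbits in the kernel of `P`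
  obtain ⟨M, c, hM⟩ := S.exists_norm_toFun_le_exp hm_cont hm
  obtain ⟨C₁, hC₁⟩ := hV.exists_bounded_leftInverse h_compact h_bdd
  have hker : ∀ v : H, ∀ s, 0 ≤ s →
      P (S.toFun s ((ContinuousLinearMap.id ℂ H - P) v)) = 0 := fun v s hs => by
    have h1 := hV.comp_rieszIntegral_comm (B := S.toFun s) fun z hz => S.toFun_comp_resolvent hz hs
    rw [← hP] at h1
    have h2 : ∀ y, P (S.toFun s y) = S.toFun s (P y) := fun y =>
      (congrArg (fun B : H →L[ℂ] H => B y) h1).symm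
    have h3 : P (P v) = P v := congrArg (fun B : H →L[ℂ] H => B v) hPP
    rw [h2]
    simp [h3]
  have hsq : ∀ v : H, S.OrbitSqIntegrable ((ContinuousLinearMap.id ℂ H - P) v) ω' := fun v =>
    S.orbitSqIntegrable_of_leftInverse hM (fun z hz => hP ▸ hC₁ z hz) (hker v)
  -- extension of `m` to a continuous function on the line
  set m' : ℝ → ℝ := fun s => m (max s 0) with hm'
  have hm'_cont : Continuous m' :=
    hm_cont.comp_continuous (by fun_prop) fun s => le_max_right s 0
  have hW : ∀ c : ℝ, 0 < c → (weightedL2Norm ω' c fun s => 1 / m s) =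
      weightedL2Norm ω' c fun s => 1 / m' s := fun c hc => by
    rw [weightedL2Norm, weightedL2Norm]
    congr 1
    refine intervalIntegral.integral_congr fun s hs => ?_
    rw [uIcc_of_le hc.le] at hs
    simp only [hm', max_eq_left hs.1]
  have hWa := C0Semigroup.weightedL2Norm_pos hm'_cont (fun s => hm_pos _ (le_max_right s 0)) ω' ha
  have hWb := C0Semigroup.weightedL2Norm_pos hm'_cont (fun s => hm_pos _ (le_max_right s 0)) ω' hb
  rw [UnboundedOperator.lineRadius, ← hC, hW a ha, hW b hb]
  refine ContinuousLinearMap.opNorm_le_bound _ ?_ fun v => ?_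
  · positivity
  have h1 := S.norm_toFun_le_of_orbitSqIntegrable hm'_cont
    (fun s => hm_pos _ (le_max_right s 0))
    (fun s hs => by simpa only [hm', max_eq_left hs] using hm s hs) hC_nonneg hE (hsq v) ha hb
  rw [hab] at h1
  -- also valid for `C = 0`, where the line radius `C⁻¹` has the value `0` and both sides vanish
  have h2 : Real.exp (ω' * t) / (C⁻¹ * (weightedL2Norm ω' a fun s => 1 / m' s) *
      weightedL2Norm ω' b fun s => 1 / m' s) = Real.exp (ω' * t) * C /
      ((weightedL2Norm ω' a fun s => 1 / m' s) * weightedL2Norm ω' b fun s => 1 / m' s) := by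
    rw [mul_assoc, div_eq_mul_inv, mul_inv, inv_inv, ← mul_assoc, ← div_eq_mul_inv]
  rw [h2, mul_assoc]
  refine h1.trans ?_
  have h3 := (ContinuousLinearMap.id ℂ H - P).le_opNorm v
  gcongr
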